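/- **Setting.** Everything is smooth. For a distribution $\mathcal V$ on a manifold put $\mathcal V^{(1)}=\mathcal V+[\mathcal V,\mathcal V]$, $\mathcal V^{(2)}=(\mathcal V^{(1)})^{(1)}$, and let $\operatorname{ch}\mathcal V$ be the Cauchy characteristic distribution, whose fibre at $q$ consists of the values $Y(q)$ of the local sections $Y$ of $\mathcal V$ with $[Y,Z](q)\in\mathcal V_q$ for all local sections $Z$ of $\mathcal V$. Let $n\ge 2$. An *$n$-hyperbolic manifold* $(M,H)$ is a manifold $M$ of dimension $3n+1$ with a distribution $H=H_1\oplus\cdots\oplus H_n$, each $H_i$ of rank $2$, such that $[H_i,H_j]\equiv 0 \bmod H$ for $i\ne j$ and $[H_i,H_i]\equiv Z_i\bmod H$ with $Z_1,\dots,Z_n$ linearly independent modulo $H$, and such that at every point $(\dim H^{(k)},\dim \operatorname{ch}H^{(k)})$ equals $(2n,0)$, $(3n,n)$, $(3n+1,3n+1)$ for $k=0,1,2$. *Adapted coordinates* on an open set $U\subseteq M$ are coordinates $x_1,\dots,x_n,y_0,\dots,y_n,u_1,\dots,u_n$ on $U$ such that $\operatorname{ch}H^{(1)}=\operatorname{span}\{\partial_{u_1},\dots,\partial_{u_n}\}$,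 together with vector fields $X_i\equiv\partial_{x_i}+\sum_{a=0}^n\rho_i^a\,\partial_{y_a}\bmod\{\partial_{u_1},\dots,\partial_{u_n}\}$ such that $\{X_i,\partial_{u_i}\}$ is a basis of $H_i$, $1\le i\le n$; $(M,H)$ is *Darboux integrable* if it has adapted coordinates. A system $u_{x_ix_j}=F_{ij}(x,u,\nabla u)$, $1\le i<j\le n$, with smooth $F_{ij}$ on an open set $W\subseteq J^1(\mathbb R^n,\mathbb R)$, is a *GDMZ system* if the restriction of the contact system of $J^2(\mathbb R^n,\mathbb R)$ to its equation manifold $\mathcal R_F=\{u_{ij}=F_{ij}(x,u,\nabla u),\ i<j\}\subset J^2(\mathbb R^n,\mathbb R)$ (over $W$) is, with independence form $dx_1\wedge\cdots\wedge dx_n$, an involutive linear Pfaffian system in the sense of Cartan: at every point the essential torsion vanishes and the tableau $A$ satisfies Cartan's test $\dim A^{(1)}=\sum_k k\,s_k$. **Theorem.** Let $(M,H)$ be a Darboux integrable $n$-hyperbolic manifold with adapted coordinates $(x,y,u)$ and adapted basis $\{X_i,\partial_{u_i}\}$ on $U$, let $\mathcal A=\operatorname{span}\{\partial_{u_i},[\partial_{u_i},X_i]: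 1\le i\le n\}$, and let $p$ be a function on $U$ such that $x_1,\dots,x_n,p$ span the invariants of $\mathcal A$, i.e. $dx_1,\dots,dx_n,dp$ span the annihilator of $\mathcal A$ at every point. Put $p_i=X_ip$, $p_{ii}=X_ip_i$ and $f_{ij}=X_jp_i$ for $i<j$. Then, on $U$: 1. $\mathcal A$ is an integrable distribution of rank $2n$. 2. $\varphi=(x_1,\dots,x_n,p,p_1,\dots,p_n,p_{11},\dots,p_{nn}):U\to\mathbb R^{3n+1}$ is a local diffeomorphism. 3. The map $\Phi:U\to J^2(\mathbb R^n,\mathbb R)$ given by $u=p$, $u_i=p_i$, $u_{ii}=p_{ii}$, $u_{ij}=f_{ij}$ $(i<j)$ is an immersion, and $H$ is the inverse image under $d\Phi$ of the contact distribution of $J^2(\mathbb R^n,\mathbb R)$. 4. The image of $\Phi$ is locally a GDMZ system: every point of $U$ has an open neighbourhood $N\subseteq U$ on which $\Phi$ is injective and for which there is a GDMZ system $u_{x_ix_j}=F_{ij}(x,u,\nabla u)$, $i<j$, such that $f_{ij}=F_{ij}(x,p,p_1,\dots,p_n)$ on $N$ (so the $f_{ij}$ do not depend on the $p_{ll}$)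 and $\Phi(N)$ is an open subset of the equation manifold $\mathcal R_F$. 5. There are one-forms $\pi^1,\dots,\pi^n,\theta^0,\dots,\theta^n$ which together with $\omega^i=dx_i$ form a coframe, with $\Theta=\{\theta^0,\dots,\theta^n\}=H^\perp$, $\pi^i(X_j)=0$, $\pi^i(\partial_{u_j})=\delta_{ij}$, and $$d\theta^0\equiv 0,\qquad d\theta^i\equiv\pi^i\wedge\omega^i\ (1\le i\le n)\quad\bmod\Theta .$$ 6. $\Theta$, with independence form $dx_1\wedge\cdots\wedge dx_n$, is an involutive linear Pfaffian system: its essential torsion vanishes, its tableau satisfies Cartan's test, and its Cartan characters are $s_1=n$ and $s_k=0$ for $k\ge2$. -/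

import Mathlib

open Set Manifold VectorField
open scoped ContDiff Topology

noncomputable section

namespace NHyp

/-! ## Vector fields and distributions on a manifold -/

section Manifolds

variable {E : Type*} [NormedAddCommGroup E] [NormedSpace ℝ E]
  {M : Type*} [TopologicalSpace M] [ChartedSpace E M]

/-- A (not necessarily smooth) vector field. -/
abbrev VField (E : Type*) [NormedAddCommGroup E] [NormedSpace ℝ E]
    (M : Type*) [TopologicalSpace M] [ChartedSpace E M] :=
  ∀ q : M, TangentSpace 𝓘(ℝ, E) q

/-- A field of tangent subspaces. -/
abbrev Distribution (E : Type*) [NormedAddCommGroup E] [NormedSpace ℝ E]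
    (M : Type*) [TopologicalSpace M] [ChartedSpace E M] :=
  ∀ q : M, Submodule ℝ (TangentSpace 𝓘(ℝ, E) q)

/-- A field of covectors. -/
abbrev OneForm (E : Type*) [NormedAddCommGroup E] [NormedSpace ℝ E]
    (M : Type*) [TopologicalSpace M] [ChartedSpace E M] :=
  ∀ q : M, Module.Dual ℝ (TangentSpace 𝓘(ℝ, E) q)

variable [IsManifold 𝓘(ℝ, E) ∞ M]

/-- `Y` is smooth on `V`, as a section of the tangent bundle. -/
def SmoothOn (Y : VField E M) (V : Set M) : Prop :=
  ContMDiffOn 𝓘(ℝ, E) (𝓘(ℝ, E)).tangent ∞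
    (fun q => (⟨q, Y q⟩ : TangentBundle 𝓘(ℝ, E) M)) V

/-- `Y` is a smooth section of `D` over `V`. -/
def IsSectionOn (D : Distribution E M) (V : Set M) (Y : VField E M) : Prop :=
  SmoothOn Y V ∧ ∀ q ∈ V, Y q ∈ D q

/-- `Y` is a smooth section of `D` over some open neighbourhood of `q`. -/
def IsLocalSection (D : Distribution E M) (q : M) (Y : VField E M) : Prop :=
  ∃ V : Set M, IsOpen V ∧ q ∈ V ∧ IsSectionOn D V Y

/-- The Lie bracket of vector fields. -/
abbrev bracket (Y Z : VField E M) : VField E M := mlieBracket 𝓘(ℝ, E) Y Z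

/-- `D` is a smooth distribution of constant rank `r`: locally spanned by a smooth frame. -/
def IsSmoothOfRank (D : Distribution E M) (r : ℕ) : Prop :=
  ∀ q : M, ∃ V : Set M, IsOpen V ∧ q ∈ V ∧ ∃ Y : Fin r → VField E M,
    (∀ k, SmoothOn (Y k) V) ∧
      ∀ q' ∈ V, LinearIndependent ℝ (fun k => Y k q') ∧
        D q' = Submodule.span ℝ (range fun k => Y k q')

/-- The derived distribution `D + [D, D]`. -/
def derived (D : Distribution E M) : Distribution E M := fun q =>
  D q ⊔ Submodule.span ℝ
    {v | ∃ Y Z : VField E M, IsLocalSection D q Y ∧ IsLocalSection D q Z ∧ v = bracket Y Z q}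

/-- The Cauchy characteristic space of `D` at each point: the values at `q` of the sections `Y`
of `D` near `q` whose brackets with all sections of `D` lie in `D` at `q`.  (These values already
form a subspace.) -/
def cauchy (D : Distribution E M) : Distribution E M := fun q =>
  Submodule.span ℝ
    {v | ∃ Y : VField E M, IsLocalSection D q Y ∧ Y q = v ∧
      ∀ Z : VField E M, IsLocalSection D q Z → bracket Y Z q ∈ D q}

/-- Frobenius integrability (closure of sections under the bracket) over the open set `U`. -/
def IsIntegrableOn (D : Distribution E M) (U : Set M) : Prop :=
  ∀ q ∈ U, ∀ Y Z : VField E M, IsLocalSection D q Y → IsLocalSection D q Z →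
    bracket Y Z q ∈ D q

/-- The differential `df` of a function. -/
def dform (f : M → ℝ) : OneForm E M := fun q =>
  (show TangentSpace 𝓘(ℝ, E) q →L[ℝ] ℝ from mfderiv 𝓘(ℝ, E) 𝓘(ℝ, ℝ) f q).toLinearMap

/-- The derivative `Y f` of the function `f` along the vector field `Y`. -/
def der (Y : VField E M) (f : M → ℝ) : M → ℝ := fun q => dform f q (Y q)

/-- A one-form is smooth on the open set `U` if it maps smooth vector fields to smooth
functions. -/
def SmoothFormOn (θ : OneForm E M) (U : Set M) : Prop :=
  ∀ V : Set M, IsOpen V → V ⊆ U → ∀ Y : VField E M, SmoothOn Y V →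
    ContMDiffOn 𝓘(ℝ, E) 𝓘(ℝ, ℝ) ∞ (fun q => θ q (Y q)) V

/-- The exterior derivative of a one-form:
`dθ(Y, Z) = Y(θ(Z)) - Z(θ(Y)) - θ([Y, Z])`. -/
def extD (θ : OneForm E M) (Y Z : VField E M) (q : M) : ℝ :=
  der Y (fun q' => θ q' (Z q')) q - der Z (fun q' => θ q' (Y q')) q - θ q (bracket Y Z q)

/-- The wedge product `α ∧ β` of one-forms. -/
def wedge (α β : OneForm E M) (Y Z : VField E M) (q : M) : ℝ :=
  α q (Y q) * β q (Z q) - α q (Z q) * β q (Y q)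

/-- The congruence `dθ ≡ Ω mod Θ` over `U`, where `Θ` is the annihilator of `D`: the two-forms
`dθ` and `Ω` agree on sections of `D`. -/
def ExtDCongr (D : Distribution E M) (U : Set M) (θ : OneForm E M)
    (Ω : VField E M → VField E M → M → ℝ) : Prop :=
  ∀ q ∈ U, ∀ Y Z : VField E M, IsLocalSection D q Y → IsLocalSection D q Z →
    extD θ Y Z q = Ω Y Z q

end Manifolds

/-! ## Tableaux, Cartan characters and Cartan's test -/

section Tableaux

variable {n : ℕ} {W : Type*} [AddCommGroup W] [Module ℝ W]

/-- A tableau: a linear space of linear maps `ℝⁿ → W`. -/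
abbrev Tableau (n : ℕ) (W : Type*) [AddCommGroup W] [Module ℝ W] :=
  Submodule ℝ ((Fin n → ℝ) →ₗ[ℝ] W)

/-- Evaluation of a linear map at `k` vectors. -/
def evalAt {k : ℕ} (v : Fin k → Fin n → ℝ) : ((Fin n → ℝ) →ₗ[ℝ] W) →ₗ[ℝ] (Fin k → W) where
  toFun a := fun j => a (v j)
  map_add' _ _ := rfl
  map_smul' _ _ := rfl

/-- `s₁ + ⋯ + s_k`: the rank of the evaluation of the tableau at `k` generic vectors, that is,
the largest such rank. -/
def characterSum (A : Tableau n W) (k : ℕ) : ℕ :=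
  ⨆ v : Fin k → Fin n → ℝ, Module.finrank ℝ (A.map (evalAt v))

/-- The Cartan character `s_k`, for `k ≥ 1`. -/
def character (A : Tableau n W) (k : ℕ) : ℕ :=
  characterSum A k - characterSum A (k - 1)

/-- The first prolongation of the tableau `A`: linear maps `P : ℝⁿ → A` with
`P v w = P w v`. -/
def prolongation (A : Tableau n W) :
    Submodule ℝ ((Fin n → ℝ) →ₗ[ℝ] (Fin n → ℝ) →ₗ[ℝ] W) where
  carrier := {P | (∀ v, P v ∈ A) ∧ ∀ v w, P v w = P w v}
  zero_mem' := ⟨fun _ => A.zero_mem, fun _ _ => rfl⟩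
  add_mem' := fun {P Q} hP hQ => ⟨fun v => A.add_mem (hP.1 v) (hQ.1 v), fun v w => by
    simp [hP.2 v w, hQ.2 v w]⟩
  smul_mem' := fun c P hP => ⟨fun v => A.smul_mem c (hP.1 v), fun v w => by
    simp [hP.2 v w]⟩

/-- Cartan's test: `dim A⁽¹⁾ = s₁ + 2 s₂ + ⋯ + n s_n`. -/
def CartanTest (A : Tableau n W) : Prop :=
  Module.finrank ℝ (prolongation A) = ∑ k ∈ Finset.Icc 1 n, k * character A k

end Tableaux

/-! ## Linear Pfaffian systems

The Pfaffian system is `I = D^⊥`, for a distribution `D`, with independence forms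
`ω₁, …, ω_n`. -/

section Pfaffian

variable {E : Type*} [NormedAddCommGroup E] [NormedSpace ℝ E]
  {M : Type*} [TopologicalSpace M] [ChartedSpace E M] [IsManifold 𝓘(ℝ, E) ∞ M] {n : ℕ}

/-- The system is a linear Pfaffian system with independence condition at `q`: the independence
forms are independent on `D`, and `dI ≡ 0 mod (I, ω₁, …, ω_n)`, that is, brackets of sections of
`D` whose values at `q` are killed by all `ω_i` lie in `D`. -/
def IsLinearPfaffianAt (D : Distribution E M) (om : Fin n → OneForm E M) (q : M) : Prop :=
  (∀ c : Fin n → ℝ, ∃ v ∈ D q, ∀ i, om i q v = c i) ∧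
    ∀ Y Z : VField E M, IsLocalSection D q Y → IsLocalSection D q Z →
      (∀ i, om i q (Y q) = 0) → (∀ i, om i q (Z q) = 0) → bracket Y Z q ∈ D q

/-- The tableau of the system at `q`.  A vector `v = Y(q)` of `D` that is killed by all `ω_i`
defines the linear map `ω(Z) ↦ [Y, Z] mod D` from `ℝⁿ` to `T_qM / D_q`. -/
def tableau (D : Distribution E M) (om : Fin n → OneForm E M) (q : M) :
    Tableau n (TangentSpace 𝓘(ℝ, E) q ⧸ D q) :=
  Submodule.span ℝ
    {a | ∃ Y : VField E M, IsLocalSection D q Y ∧ (∀ i, om i q (Y q) = 0) ∧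
      ∀ Z : VField E M, IsLocalSection D q Z →
        a (fun i => om i q (Z q)) = (D q).mkQ (bracket Y Z q)}

/-- The (essential) torsion vanishes at `q`: a complement of the space of vectors of `D` killed by
the `ω_i` can be chosen in `D` on which the torsion is zero; equivalently there is an integral
element at `q` on which `ω₁, …, ω_n` are independent. -/
def TorsionVanishesAt (D : Distribution E M) (om : Fin n → OneForm E M) (q : M) : Prop :=
  ∃ Z : Fin n → VField E M, (∀ i, IsLocalSection D q (Z i)) ∧
    (∀ i j, om j q (Z i q) = if i = j then 1 else 0) ∧
    ∀ i j, bracket (Z i) (Z j) q ∈ D q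

/-- Involutivity, in the sense of Cartan, of the linear Pfaffian system at `q`. -/
def IsInvolutiveAt (D : Distribution E M) (om : Fin n → OneForm E M) (q : M) : Prop :=
  IsLinearPfaffianAt D om q ∧ TorsionVanishesAt D om q ∧ CartanTest (tableau D om q)

end Pfaffian

/-! ## Jet spaces and generalised Darboux-Manakov-Zakharov systems -/

section Jets

/-- The jet space `J¹(ℝⁿ, ℝ)`, with coordinates `(x_i, u, u_i)`. -/
abbrev J1 (n : ℕ) := (Fin n → ℝ) × ℝ × (Fin n → ℝ)

/-- The jet space `J²(ℝⁿ, ℝ)`, with coordinates `(x_i, u, u_i, u_{ij})`; the second derivatives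
are indexed by unordered pairs. -/
abbrev J2 (n : ℕ) := (Fin n → ℝ) × ℝ × (Fin n → ℝ) × (Sym2 (Fin n) → ℝ)

/-- The space of the variables `(x_i, u, u_i, u_{ii})`. -/
abbrev JDiag (n : ℕ) := (Fin n → ℝ) × ℝ × (Fin n → ℝ) × (Fin n → ℝ)

/-- The projection `J² → J¹`. -/
def J2.toJ1 {n : ℕ} (z : J2 n) : J1 n := (z.1, z.2.1, z.2.2.1)

/-- The projection that forgets the pure second derivatives. -/
def JDiag.toJ1 {n : ℕ} (z : JDiag n) : J1 n := (z.1, z.2.1, z.2.2.1)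

/-- The contact distribution on `J²`: the common kernel of `du - ∑ u_i dx_i` and
`du_i - ∑ u_{ij} dx_j`. -/
def contact (n : ℕ) : Distribution (J2 n) (J2 n) := fun z =>
  { carrier := {v : J2 n | v.2.1 = ∑ i, z.2.2.1 i * v.1 i ∧
      ∀ i, v.2.2.1 i = ∑ j, z.2.2.2 s(i, j) * v.1 j}
    zero_mem' := by
      constructor
      · change (0 : ℝ) = ∑ i, z.2.2.1 i * (0 : ℝ)
        simp
      · intro i
        change (0 : ℝ) = ∑ j, z.2.2.2 s(i, j) * (0 : ℝ)
        simp
    add_mem' := by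
      intro (v : J2 n) (w : J2 n) hv hw
      constructor
      · change v.2.1 + w.2.1 = ∑ i, z.2.2.1 i * (v.1 i + w.1 i)
        rw [hv.1, hw.1, ← Finset.sum_add_distrib]
        simp only [mul_add]
      · intro i
        change v.2.2.1 i + w.2.2.1 i = ∑ j, z.2.2.2 s(i, j) * (v.1 j + w.1 j)
        rw [hv.2 i, hw.2 i, ← Finset.sum_add_distrib]
        simp only [mul_add]
    smul_mem' := by
      intro c (v : J2 n) hv
      constructor
      · change c * v.2.1 = ∑ i, z.2.2.1 i * (c * v.1 i)
        rw [hv.1, Finset.mul_sum]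
        exact Finset.sum_congr rfl fun i _ => by ring
      · intro i
        change c * v.2.2.1 i = ∑ j, z.2.2.2 s(i, j) * (c * v.1 j)
        rw [hv.2 i, Finset.mul_sum]
        exact Finset.sum_congr rfl fun j _ => by ring }

variable {n : ℕ}

/-- The submanifold of `J²` defined by the equations `u_{ij} = F_{ij}(x, u, ∇u)`, `i < j`, with
right-hand sides defined for `(x, u, ∇u) ∈ W`. -/
def equationManifold (W : Set (J1 n)) (F : Fin n → Fin n → J1 n → ℝ) : Set (J2 n) :=
  {z | z.toJ1 ∈ W ∧ ∀ i j, i < j → z.2.2.2 s(i, j) = F i j z.toJ1}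

/-- The parametrisation of the equation manifold by `(x_i, u, u_i, u_{ii})`. -/
def equationParam (F : Fin n → Fin n → J1 n → ℝ) (z : JDiag n) : J2 n :=
  (z.1, z.2.1, z.2.2.1, fun s =>
    if s.inf = s.sup then z.2.2.2 s.inf else F s.inf s.sup z.toJ1)

/-- `equationParam` maps the points over `W` onto the equation manifold. -/
theorem equationParam_image (W : Set (J1 n)) (F : Fin n → Fin n → J1 n → ℝ) :
    equationParam F '' {z | z.toJ1 ∈ W} = equationManifold W F := by
  ext z
  constructor
  · rintro ⟨w, hw, rfl⟩
    refine ⟨hw, fun i j hij => ?_⟩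
    have h1 : i ⊓ j = i := inf_eq_left.2 hij.le
    have h2 : i ⊔ j = j := sup_eq_right.2 hij.le
    simp only [equationParam, Sym2.inf_mk, Sym2.sup_mk, h1, h2, if_neg hij.ne]
    rfl
  · rintro ⟨hz, h⟩
    refine ⟨(z.1, z.2.1, z.2.2.1, fun i => z.2.2.2 s(i, i)), hz, ?_⟩
    refine Prod.ext rfl (Prod.ext rfl (Prod.ext rfl ?_))
    funext s
    induction s using Sym2.ind with
    | _ a b =>
      rcases lt_trichotomy a b with hab | hab | hab
      · have h1 : a ⊓ b = a := inf_eq_left.2 hab.le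
        have h2 : a ⊔ b = b := sup_eq_right.2 hab.le
        simp only [equationParam, Sym2.inf_mk, Sym2.sup_mk, h1, h2, if_neg hab.ne]
        exact (h a b hab).symm
      · subst hab
        simp [equationParam]
      · have h1 : a ⊓ b = b := inf_eq_right.2 hab.le
        have h2 : a ⊔ b = a := sup_eq_left.2 hab.le
        simp only [equationParam, Sym2.inf_mk, Sym2.sup_mk, h1, h2, if_neg hab.ne]
        rw [Sym2.eq_swap]
        exact (h b a hab).symm

/-- The restriction of the contact distribution to the equation manifold, in the parameters
`(x_i, u, u_i, u_{ii})`. -/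
def equationDistribution (F : Fin n → Fin n → J1 n → ℝ) : Distribution (JDiag n) (JDiag n) :=
  fun z => (contact n (equationParam F z)).comap
    (mfderiv 𝓘(ℝ, JDiag n) 𝓘(ℝ, J2 n) (equationParam F) z :
      TangentSpace 𝓘(ℝ, JDiag n) z →ₗ[ℝ] TangentSpace 𝓘(ℝ, J2 n) (equationParam F z))

/-- The system `u_{ij} = F_{ij}(x, u, ∇u)`, `i < j`, with smooth right-hand sides on the open set
`W`, is a generalised Darboux-Manakov-Zakharov system: the contact system, restricted to the
equation manifold and with independence forms `dx_1, …, dx_n`, is involutive at every point. -/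
def IsGDMZ (W : Set (J1 n)) (F : Fin n → Fin n → J1 n → ℝ) : Prop :=
  IsOpen W ∧ (∀ i j, i < j → ContDiffOn ℝ ∞ (F i j) W) ∧
    ∀ z : JDiag n, z.toJ1 ∈ W →
      IsInvolutiveAt (equationDistribution F)
        (fun i => dform (E := JDiag n) (fun z' : JDiag n => z'.1 i)) z

end Jets

/-! ## n-hyperbolic manifolds and adapted coordinates -/

section Hyperbolic

variable {E : Type*} [NormedAddCommGroup E] [NormedSpace ℝ E]
  {M : Type*} [TopologicalSpace M] [ChartedSpace E M] [IsManifold 𝓘(ℝ, E) ∞ M] {n : ℕ}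

/-- `H = H_1 + ⋯ + H_n`. -/
def total (Hs : Fin n → Distribution E M) : Distribution E M := fun q => ⨆ i, Hs i q

/-- `M`, with the distribution `H = H_1 ⊕ ⋯ ⊕ H_n`, is an `n`-hyperbolic manifold. -/
structure IsNHyperbolic (Hs : Fin n → Distribution E M) : Prop where
  dim_eq : Module.finrank ℝ E = 3 * n + 1
  rank_two : ∀ i, IsSmoothOfRank (Hs i) 2
  direct_sum : ∀ q, iSupIndep fun i => Hs i q
  /-- `[H_i, H_j] ≡ 0 mod H` for `i ≠ j` -/
  bracket_ne : ∀ i j, i ≠ j → ∀ q, ∀ Y Z : VField E M,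
    IsLocalSection (Hs i) q Y → IsLocalSection (Hs j) q Z → bracket Y Z q ∈ total Hs q
  /-- `[H_i, H_i] ≡ Z_i mod H` with `Z_1 ∧ ⋯ ∧ Z_n ≠ 0` modulo `H` -/
  bracket_self : ∀ q, ∃ Z : Fin n → TangentSpace 𝓘(ℝ, E) q,
    LinearIndependent ℝ (fun i => (total Hs q).mkQ (Z i)) ∧
    ∀ i, total Hs q ⊔ Submodule.span ℝ {v | ∃ Y Y' : VField E M, IsLocalSection (Hs i) q Y ∧
        IsLocalSection (Hs i) q Y' ∧ v = bracket Y Y' q} =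
      total Hs q ⊔ Submodule.span ℝ {Z i}
  /-- the derived type is `[[2n, 0], [3n, n], [3n + 1, 3n + 1]]` -/
  rank_zero : ∀ q, Module.finrank ℝ (total Hs q) = 2 * n
  cauchy_zero : ∀ q, Module.finrank ℝ (cauchy (total Hs) q) = 0
  rank_one : ∀ q, Module.finrank ℝ (derived (total Hs) q) = 3 * n
  cauchy_one : ∀ q, Module.finrank ℝ (cauchy (derived (total Hs)) q) = n
  rank_derived_two : ∀ q, Module.finrank ℝ (derived (derived (total Hs)) q) = 3 * n + 1
  cauchy_derived_two :
    ∀ q, Module.finrank ℝ (cauchy (derived (derived (total Hs))) q) = 3 * n + 1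

/-- The space of the adapted coordinates `(x_1, …, x_n, y_0, …, y_n, u_1, …, u_n)`. -/
abbrev Coord (n : ℕ) := (Fin n → ℝ) × (Fin (n + 1) → ℝ) × (Fin n → ℝ)

/-- A system of smooth local coordinates `(x, y, u)` on `M`. -/
abbrev CoordSystem (n : ℕ) (E : Type*) [NormedAddCommGroup E] [NormedSpace ℝ E]
    (M : Type*) [TopologicalSpace M] [ChartedSpace E M] :=
  PartialDiffeomorph 𝓘(ℝ, E) 𝓘(ℝ, Coord n) M (Coord n) ∞

/-- The coordinate vector field of `χ` in the constant direction `c`: `q ↦ (dχ_q)⁻¹ c`. -/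
def coordField (χ : CoordSystem n E M) (c : Coord n) : VField E M :=
  mpullback 𝓘(ℝ, E) 𝓘(ℝ, Coord n) χ (fun _ => c)

/-- The coordinate function `x_i`. -/
def xfun (χ : CoordSystem n E M) (i : Fin n) : M → ℝ := fun q => (χ q).1 i

/-- The coordinate vector field `∂/∂x_i`. -/
def ddx (χ : CoordSystem n E M) (i : Fin n) : VField E M :=
  coordField χ (Pi.single i 1, 0, 0)

/-- The coordinate vector field `∂/∂y_a`. -/
def ddy (χ : CoordSystem n E M) (a : Fin (n + 1)) : VField E M :=
  coordField χ (0, Pi.single a 1, 0)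

/-- The coordinate vector field `∂/∂u_i`. -/
def ddu (χ : CoordSystem n E M) (i : Fin n) : VField E M :=
  coordField χ (0, 0, Pi.single i 1)

/-- The coordinates `χ = (x, y, u)`, with domain `U = χ.source`, are adapted to the
`n`-hyperbolic structure, with adapted basis `X_1, …, X_n, ∂/∂u_1, …, ∂/∂u_n`.  The manifold is
Darboux integrable when it has such coordinates. -/
structure IsAdapted (Hs : Fin n → Distribution E M) (χ : CoordSystem n E M)
    (X : Fin n → VField E M) : Prop where
  /-- `ch H⁽¹⁾ = {∂/∂u_1, …, ∂/∂u_n}` -/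
  cauchy_eq : ∀ q ∈ χ.source,
    cauchy (derived (total Hs)) q = Submodule.span ℝ (range fun i => ddu χ i q)
  smooth : ∀ i, SmoothOn (X i) χ.source
  /-- `X_i = ∂/∂x_i + ∑ ρ^a_i ∂/∂y_a mod {∂/∂u_1, …, ∂/∂u_n}` -/
  form : ∀ i, ∀ q ∈ χ.source, ∃ (ρ : Fin (n + 1) → ℝ) (σ : Fin n → ℝ),
    X i q = ddx χ i q + ∑ a, ρ a • ddy χ a q + ∑ k, σ k • ddu χ k q
  /-- `{X_i, ∂/∂u_i}` is a basis of `H_i` -/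
  basis : ∀ i, ∀ q ∈ χ.source, LinearIndependent ℝ ![X i q, ddu χ i q] ∧
    Hs i q = Submodule.span ℝ {X i q, ddu χ i q}

/-- The distribution `𝒜` spanned by `∂/∂u_i` and `[∂/∂u_i, X_i]`, `1 ≤ i ≤ n`. -/
def calA (χ : CoordSystem n E M) (X : Fin n → VField E M) : Distribution E M := fun q =>
  Submodule.span ℝ (range (fun i => ddu χ i q) ∪ range (fun i => bracket (ddu χ i) (X i) q))

/-- The functions `x_1, …, x_n, p` span the invariants of `𝒜`: `p` is smooth and
`dx_1, …, dx_n, dp` span the annihilator of `𝒜` at every point of the coordinate domain. -/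
def SpansInvariants (χ : CoordSystem n E M) (X : Fin n → VField E M) (p : M → ℝ) : Prop :=
  ContMDiffOn 𝓘(ℝ, E) 𝓘(ℝ, ℝ) ∞ p χ.source ∧
    ∀ q ∈ χ.source,
      Submodule.span ℝ (range (fun i => dform (xfun χ i) q) ∪ {dform p q}) =
        (calA χ X q).dualAnnihilator

/-- `p_i = X_i p`. -/
def p1 (X : Fin n → VField E M) (p : M → ℝ) (i : Fin n) : M → ℝ := der (X i) p

/-- `X_j p_i`, which is `p_{ii}` for `i = j` and `f_{ij}` for `i < j`. -/
def p2 (X : Fin n → VField E M) (p : M → ℝ) (i j : Fin n) : M → ℝ := der (X j) (p1 X p i)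

/-- The map `φ = (x_i, p, p_i, p_{ii})`. -/
def phi (χ : CoordSystem n E M) (X : Fin n → VField E M) (p : M → ℝ) : M → JDiag n := fun q =>
  (fun i => xfun χ i q, p q, fun i => p1 X p i q, fun i => p2 X p i i q)

/-- The map `Φ : M → J²` with `u = p`, `u_i = p_i`, `u_{ii} = p_{ii}`, and `u_{ij} = f_{ij}` for
`i < j`. -/
def Phi (χ : CoordSystem n E M) (X : Fin n → VField E M) (p : M → ℝ) : M → J2 n := fun q =>
  (fun i => xfun χ i q, p q, fun i => p1 X p i q, fun s => p2 X p s.inf s.sup q)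

/-- The differential of `Φ`. -/
def dPhi (χ : CoordSystem n E M) (X : Fin n → VField E M) (p : M → ℝ) (q : M) :
    TangentSpace 𝓘(ℝ, E) q →ₗ[ℝ] TangentSpace 𝓘(ℝ, J2 n) (Phi χ X p q) :=
  (mfderiv 𝓘(ℝ, E) 𝓘(ℝ, J2 n) (Phi χ X p) q :
    TangentSpace 𝓘(ℝ, E) q →ₗ[ℝ] TangentSpace 𝓘(ℝ, J2 n) (Phi χ X p q))

end Hyperbolic

end NHyp

end

open NHyp

/-!
Put `a_i = [∂/∂u_i, X_i] p_i`. A bracket of sections of different `H_i` lies in `H`, and the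
brackets of the fields `X_i`, `∂/∂u_k` are annihilated by all `dx_l`; hence `[∂/∂u_k, X_j]` for
`k ≠ j` and `[X_i, X_j]` are vertical, that is, combinations of the `∂/∂u_l`. Consequently the
`∂/∂u_k` annihilate `p` and the `p_i`, the functions `p_{ij} = X_j p_i` are symmetric, and
`∂p_{ij}/∂u_k` is `a_k` if `i = j = k` and zero otherwise. Since
`H⁽¹⁾ = ker (dp - ∑ p_i dx_i)`, a zero of `a_i` would make `[∂/∂u_i, X_i]` a further Cauchy
characteristic of `H⁽¹⁾` there; so `a_i ≠ 0`. Therefore `H` is the common kernel of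
`dp - ∑ p_i dx_i` and the `dp_i - ∑ p_{ij} dx_j`, the tableau is diagonal, and its entries are the
multiples `π^i` of `dp_{ii}` modulo `dx_1, …, dx_n`.

In the coordinates `(x, p, p_i, p_{ii})` the `f_{ij}` have zero derivative along the pure second
derivatives, hence are functions `F_{ij}` of `(x, p, p_k)` alone. Equality of the mixed
derivatives `X_k p_{ij} = X_j p_{ik}` is the compatibility condition for the `F_{ij}`. It is
affine in the pure second derivatives, so that its validity on the image of `Φ`, which is open in
the equation manifold, propagates to the whole equation manifold over the domain of the `F_{ij}`.
-/

namespace NHyp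

section Calculus

variable {E : Type*} [NormedAddCommGroup E] [NormedSpace ℝ E]
  {M : Type*} [TopologicalSpace M] [ChartedSpace E M]

theorem mdifferentiableAt_of_contMDiffOn {f : M → ℝ} {V : Set M} (hV : IsOpen V)
    (hf : ContMDiffOn 𝓘(ℝ, E) 𝓘(ℝ, ℝ) ∞ f V) {q : M} (hq : q ∈ V) :
    MDifferentiableAt 𝓘(ℝ, E) 𝓘(ℝ, ℝ) f q :=
  (hf.contMDiffAt (hV.mem_nhds hq)).mdifferentiableAt (by simp)

theorem dform_congr {f g : M → ℝ} {q : M} (h : f =ᶠ[𝓝 q] g) :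
    dform (E := E) f q = dform g q :=
  LinearMap.ext fun v => congrArg (fun L : E →L[ℝ] ℝ => L v)
    (h.mfderiv_eq (I := 𝓘(ℝ, E)) (I' := 𝓘(ℝ, ℝ)))

theorem dform_const (c : ℝ) (q : M) : dform (E := E) (fun _ : M => c) q = 0 :=
  LinearMap.ext fun v => congrArg (fun L : E →L[ℝ] ℝ => L v)
    (mfderiv_const (I := 𝓘(ℝ, E)) (I' := 𝓘(ℝ, ℝ)) (x := q) (c := c))

theorem dform_sum_mul {ι : Type} [Fintype ι] {a g : ι → M → ℝ} {q : M}
    (ha : ∀ i, MDifferentiableAt 𝓘(ℝ, E) 𝓘(ℝ, ℝ) (a i) q)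
    (hg : ∀ i, MDifferentiableAt 𝓘(ℝ, E) 𝓘(ℝ, ℝ) (g i) q) (v : TangentSpace 𝓘(ℝ, E) q) :
    dform (fun q' => ∑ i, a i q' * g i q') q v =
      ∑ i, (a i q * dform (g i) q v + g i q * dform (a i) q v) := by
  have h := (HasMFDerivAt.sum (t := Finset.univ) fun i _ =>
    (ha i).hasMFDerivAt.mul (hg i).hasMFDerivAt).mfderiv
  have hfun : (∑ i, a i * g i) = fun q' => ∑ i, a i q' * g i q' := by ext; simp
  rw [hfun] at h
  rw [dform, h]
  exact sum_apply (F := E →L[ℝ] ℝ) _ _ _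

theorem dform_eq_fderiv_chart {f : M → ℝ} {q : M}
    (hf : MDifferentiableAt 𝓘(ℝ, E) 𝓘(ℝ, ℝ) f q) (v : TangentSpace 𝓘(ℝ, E) q) :
    dform f q v = fderiv ℝ (f ∘ (extChartAt 𝓘(ℝ, E) q).symm) (extChartAt 𝓘(ℝ, E) q q) v := by
  have h : mfderiv 𝓘(ℝ, E) 𝓘(ℝ, ℝ) f q =
      fderiv ℝ (f ∘ (extChartAt 𝓘(ℝ, E) q).symm) (extChartAt 𝓘(ℝ, E) q q) := by
    rw [hf.mfderiv]
    simp only [writtenInExtChartAt, modelWithCornersSelf_coe, range_id,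
      fderivWithin_univ, extChartAt_model_space_eq_id, PartialEquiv.refl_coe, Function.id_comp]
    rfl
  exact congrArg (fun L : E →L[ℝ] ℝ => L v) h

theorem contDiffAt_comp_extChartAt_symm {f : M → ℝ} {q : M}
    (hf : ContMDiffAt 𝓘(ℝ, E) 𝓘(ℝ, ℝ) ∞ f q) :
    ContDiffAt ℝ ∞ (f ∘ (extChartAt 𝓘(ℝ, E) q).symm) (extChartAt 𝓘(ℝ, E) q q) := by
  have h := (contMDiffAt_iff.1 hf).2
  rw [modelWithCornersSelf_coe, range_id, contDiffWithinAt_univ] at h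
  simpa only [extChartAt_model_space_eq_id, PartialEquiv.refl_coe, Function.id_comp] using h

/-- The representative of the vector field `Y` in the preferred chart at `q`, used to transfer the
calculus of Lie brackets from the model space. -/
noncomputable def chartField (q : M) (Y : VField E M) : E → E :=
  mpullbackWithin 𝓘(ℝ, E) 𝓘(ℝ, E) (extChartAt 𝓘(ℝ, E) q).symm Y univ

variable [IsManifold 𝓘(ℝ, E) ∞ M]

theorem chartField_extChartAt_self (q : M) (Y : VField E M) :
    chartField q Y (extChartAt 𝓘(ℝ, E) q q) = Y q := by
  have h := mfderivWithin_range_extChartAt_symm (I := 𝓘(ℝ, E)) (x := q)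
  simp only [modelWithCornersSelf_coe, range_id] at h
  rw [chartField, mpullbackWithin_apply, h, extChartAt_to_inv]
  exact congrArg (fun L : E →L[ℝ] E => L _) ContinuousLinearMap.inverse_id

theorem bracket_eq_lieBracket_chartField (q : M) (Y Z : VField E M) :
    bracket Y Z q =
      lieBracket ℝ (chartField q Y) (chartField q Z) (extChartAt 𝓘(ℝ, E) q q) := by
  rw [bracket, mlieBracket, mlieBracketWithin_apply, modelWithCornersSelf_coe, range_id,
    preimage_univ, univ_inter, mfderiv_extChartAt_self]
  exact (congrArg (fun L : E →L[ℝ] E => L _) ContinuousLinearMap.inverse_id).trans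
    (congrFun lieBracketWithin_univ _)

theorem SmoothOn.differentiableAt_chartField [CompleteSpace E] {Y : VField E M} {V : Set M}
    (hY : SmoothOn Y V) (hV : IsOpen V) {q : M} (hq : q ∈ V) :
    DifferentiableAt ℝ (chartField q Y) (extChartAt 𝓘(ℝ, E) q q) := by
  have hYq := (hY.contMDiffAt (hV.mem_nhds hq)).mdifferentiableAt (by simp)
  rw [← mdifferentiableWithinAt_univ] at hYq
  have h := hYq.differentiableWithinAt_mpullbackWithin_vectorField
  rw [modelWithCornersSelf_coe, range_id, preimage_univ, univ_inter] at h
  exact differentiableWithinAt_univ.1 h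

theorem SmoothOn.contMDiffOn_der {Y : VField E M} {f : M → ℝ} {V : Set M} (hY : SmoothOn Y V)
    (hV : IsOpen V) (hf : ContMDiffOn 𝓘(ℝ, E) 𝓘(ℝ, ℝ) ∞ f V) :
    ContMDiffOn 𝓘(ℝ, E) 𝓘(ℝ, ℝ) ∞ (der Y f) V := by
  have htangent : ContMDiffOn (𝓘(ℝ, E)).tangent (𝓘(ℝ, ℝ)).tangent ∞
      (tangentMapWithin 𝓘(ℝ, E) 𝓘(ℝ, ℝ) f V) (Bundle.TotalSpace.proj ⁻¹' V) :=
    hf.contMDiffOn_tangentMapWithin (by simp) hV.uniqueMDiffOn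
  refine ((contMDiff_snd_tangentBundle_modelSpace ℝ 𝓘(ℝ, ℝ) (n := ∞)).comp_contMDiffOn
    (htangent.comp hY fun q hq => hq)).congr fun q hq => ?_
  exact congrArg (fun L : TangentSpace 𝓘(ℝ, E) q →L[ℝ] TangentSpace 𝓘(ℝ, ℝ) (f q) => L (Y q))
    (mfderivWithin_of_isOpen hV hq).symm

theorem SmoothOn.bracket [CompleteSpace E] {Y Z : VField E M} {V : Set M} (hV : IsOpen V)
    (hY : SmoothOn Y V) (hZ : SmoothOn Z V) : SmoothOn (bracket Y Z) V := by
  intro q hq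
  refine ContMDiffAt.contMDiffWithinAt ?_
  have : IsManifold 𝓘(ℝ, E) (((⊤ : ℕ∞) : WithTop ℕ∞) + 1) M := by simpa
  have : IsManifold 𝓘(ℝ, E) (minSmoothness ℝ 2) M := by
    rw [minSmoothness_of_isRCLikeNormedField]; infer_instance
  exact ContMDiffAt.mlieBracket_vectorField (m := ⊤) (n := ⊤)
    (hY.contMDiffAt (hV.mem_nhds hq)) (hZ.contMDiffAt (hV.mem_nhds hq)) (by simp)

theorem fderiv_chartField_eventuallyEq_der {f : M → ℝ} {V : Set M} (hV : IsOpen V)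
    (hf : ContMDiffOn 𝓘(ℝ, E) 𝓘(ℝ, ℝ) ∞ f V) {q : M} (hq : q ∈ V) (Y : VField E M) :
    (fun y => fderiv ℝ (f ∘ (extChartAt 𝓘(ℝ, E) q).symm) y (chartField q Y y))
      =ᶠ[𝓝 (extChartAt 𝓘(ℝ, E) q q)] der Y f ∘ (extChartAt 𝓘(ℝ, E) q).symm := by
  have hopen : IsOpen ((extChartAt 𝓘(ℝ, E) q).target ∩ (extChartAt 𝓘(ℝ, E) q).symm ⁻¹' V) :=
    (continuousOn_extChartAt_symm q).isOpen_inter_preimage (isOpen_extChartAt_target q) hV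
  filter_upwards [hopen.mem_nhds ⟨mem_extChartAt_target q, by simpa using hq⟩] with y hy
  have hsymm : MDifferentiableAt 𝓘(ℝ, E) 𝓘(ℝ, E) (extChartAt 𝓘(ℝ, E) q).symm y := by
    simpa [mdifferentiableWithinAt_univ] using
      mdifferentiableWithinAt_extChartAt_symm (I := 𝓘(ℝ, E)) hy.1
  obtain ⟨L, hL⟩ :
      (mfderiv 𝓘(ℝ, E) 𝓘(ℝ, E) (extChartAt 𝓘(ℝ, E) q).symm y).IsInvertible := by
    simpa [mfderivWithin_univ] using
      isInvertible_mfderivWithin_extChartAt_symm (I := 𝓘(ℝ, E)) hy.1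
  have hchain := mfderiv_comp y (mdifferentiableAt_of_contMDiffOn hV hf hy.2) hsymm
  rw [mfderiv_eq_fderiv] at hchain
  rw [chartField, mpullbackWithin_univ, mpullback_apply]
  refine (congrArg (fun L => L ((mfderiv 𝓘(ℝ, E) 𝓘(ℝ, E)
    (extChartAt 𝓘(ℝ, E) q).symm y).inverse (Y ((extChartAt 𝓘(ℝ, E) q).symm y)))) hchain).trans
    (congrArg (mfderiv 𝓘(ℝ, E) 𝓘(ℝ, ℝ) f ((extChartAt 𝓘(ℝ, E) q).symm y)) ?_)
  rw [← hL, ContinuousLinearMap.inverse_equiv]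
  exact L.apply_symm_apply _

variable {Y Z : VField E M} {f : M → ℝ} {V : Set M} {q : M}

theorem der_der_of_dform_eq_sum {ι : Type} [Fintype ι] {a x : ι → M → ℝ} (hV : IsOpen V)
    (hZ : SmoothOn Z V) (ha : ∀ j, ContMDiffOn 𝓘(ℝ, E) 𝓘(ℝ, ℝ) ∞ (a j) V)
    (hx : ∀ j, ContMDiffOn 𝓘(ℝ, E) 𝓘(ℝ, ℝ) ∞ (x j) V)
    (hZf : ∀ q ∈ V, dform f q (Z q) = ∑ j, a j q * dform (x j) q (Z q)) (hq : q ∈ V)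
    (Y : VField E M) :
    der Y (der Z f) q =
      ∑ j, (a j q * der Y (der Z (x j)) q + der Z (x j) q * der Y (a j) q) := by
  have h : der Z f =ᶠ[𝓝 q] fun q' => ∑ j, a j q' * der Z (x j) q' := by
    filter_upwards [hV.mem_nhds hq] with q' hq' using hZf q' hq'
  rw [der, dform_congr h, dform_sum_mul
    (fun j => mdifferentiableAt_of_contMDiffOn hV (ha j) hq)
    (fun j => mdifferentiableAt_of_contMDiffOn hV (hZ.contMDiffOn_der hV (hx j)) hq)]
  rfl

variable [CompleteSpace E]

theorem der_bracket (hV : IsOpen V) (hY : SmoothOn Y V) (hZ : SmoothOn Z V)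
    (hf : ContMDiffOn 𝓘(ℝ, E) 𝓘(ℝ, ℝ) ∞ f V) (hq : q ∈ V) :
    der (bracket Y Z) f q = der Y (der Z f) q - der Z (der Y f) q := by
  have h := fderiv_apply_lieBracket
    (contDiffAt_comp_extChartAt_symm (hf.contMDiffAt (hV.mem_nhds hq)))
    (by rw [minSmoothness_of_isRCLikeNormedField]; exact WithTop.coe_le_coe.2 le_top)
    (hZ.differentiableAt_chartField hV hq) (hY.differentiableAt_chartField hV hq)
  rw [(fderiv_chartField_eventuallyEq_der hV hf hq Z).fderiv_eq,
    (fderiv_chartField_eventuallyEq_der hV hf hq Y).fderiv_eq,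
    chartField_extChartAt_self, chartField_extChartAt_self] at h
  rw [der, der, der, dform_eq_fderiv_chart (mdifferentiableAt_of_contMDiffOn hV hf hq),
    dform_eq_fderiv_chart (mdifferentiableAt_of_contMDiffOn hV (hZ.contMDiffOn_der hV hf) hq),
    dform_eq_fderiv_chart (mdifferentiableAt_of_contMDiffOn hV (hY.contMDiffOn_der hV hf) hq),
    bracket_eq_lieBracket_chartField]
  exact h

theorem dform_bracket_of_left_const (hV : IsOpen V) (hY : SmoothOn Y V) (hZ : SmoothOn Z V)
    (hf : ContMDiffOn 𝓘(ℝ, E) 𝓘(ℝ, ℝ) ∞ f V) {c : ℝ} (hYf : ∀ q ∈ V, dform f q (Y q) = c)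
    (hq : q ∈ V) : dform f q (bracket Y Z q) = dform (der Z f) q (Y q) := by
  have hconst : der Y f =ᶠ[𝓝 q] fun _ => c := by
    filter_upwards [hV.mem_nhds hq] with q' hq' using hYf q' hq'
  have hzero : der Z (der Y f) q = 0 := by
    rw [der, dform_congr hconst, dform_const]; rfl
  exact (der_bracket hV hY hZ hf hq).trans (by rw [hzero, sub_zero]; rfl)

theorem dform_bracket_of_const (hV : IsOpen V) (hY : SmoothOn Y V) (hZ : SmoothOn Z V)
    (hf : ContMDiffOn 𝓘(ℝ, E) 𝓘(ℝ, ℝ) ∞ f V) {c c' : ℝ} (hYf : ∀ q ∈ V, dform f q (Y q) = c)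
    (hZf : ∀ q ∈ V, dform f q (Z q) = c') (hq : q ∈ V) : dform f q (bracket Y Z q) = 0 := by
  have hconst : der Z f =ᶠ[𝓝 q] fun _ => c' := by
    filter_upwards [hV.mem_nhds hq] with q' hq' using hZf q' hq'
  rw [dform_bracket_of_left_const hV hY hZ hf hYf hq, dform_congr hconst, dform_const]
  rfl

/-- The congruence `d(df - ∑ a_j dx_j) = -∑ da_j ∧ dx_j`, evaluated on two vector fields that are
annihilated by `df - ∑ a_j dx_j`. -/
theorem dform_bracket_of_dform_eq_sum {ι : Type} [Fintype ι] {a x : ι → M → ℝ} (hV : IsOpen V)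
    (hY : SmoothOn Y V) (hZ : SmoothOn Z V) (hf : ContMDiffOn 𝓘(ℝ, E) 𝓘(ℝ, ℝ) ∞ f V)
    (ha : ∀ j, ContMDiffOn 𝓘(ℝ, E) 𝓘(ℝ, ℝ) ∞ (a j) V)
    (hx : ∀ j, ContMDiffOn 𝓘(ℝ, E) 𝓘(ℝ, ℝ) ∞ (x j) V)
    (hYf : ∀ q ∈ V, dform f q (Y q) = ∑ j, a j q * dform (x j) q (Y q))
    (hZf : ∀ q ∈ V, dform f q (Z q) = ∑ j, a j q * dform (x j) q (Z q)) (hq : q ∈ V) :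
    dform f q (bracket Y Z q) = ∑ j, a j q * dform (x j) q (bracket Y Z q) +
      ∑ j, (dform (a j) q (Y q) * dform (x j) q (Z q) -
        dform (a j) q (Z q) * dform (x j) q (Y q)) := by
  have hbracket := der_bracket hV hY hZ hf hq
  have hbracket_x := fun j => der_bracket hV hY hZ (hx j) hq
  rw [der_der_of_dform_eq_sum hV hZ ha hx hZf hq Y,
    der_der_of_dform_eq_sum hV hY ha hx hYf hq Z] at hbracket
  simp only [der] at hbracket hbracket_x
  rw [hbracket, ← Finset.sum_sub_distrib, ← Finset.sum_add_distrib]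
  simp only [hbracket_x]
  exact Finset.sum_congr rfl fun j _ => by ring

end Calculus

section DiagonalTableaux

variable {n : ℕ} {W : Type*} [AddCommGroup W] [Module ℝ W]

/-- The linear map `v ↦ (c ↦ ∑ v_i c_i b_i)`.  Its range is the diagonal tableau with respect to
the vectors `b_i`. -/
def diagMap (b : Fin n → W) : (Fin n → ℝ) →ₗ[ℝ] (Fin n → ℝ) →ₗ[ℝ] W :=
  LinearMap.mk₂ ℝ (fun v c => ∑ i, (v i * c i) • b i)
    (fun v v' c => by simp [add_mul, add_smul, Finset.sum_add_distrib])
    (fun r v c => by simp [Finset.smul_sum, mul_smul])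
    (fun v c c' => by simp [mul_add, add_smul, Finset.sum_add_distrib])
    (fun r v c => by simp [Finset.smul_sum, mul_smul, smul_comm _ r])

theorem diagMap_apply (b : Fin n → W) (v c : Fin n → ℝ) :
    diagMap b v c = ∑ i, (v i * c i) • b i := rfl

theorem diagMap_single_right (b : Fin n → W) (v : Fin n → ℝ) (j : Fin n) :
    diagMap b v (Pi.single j 1) = v j • b j := by
  rw [diagMap_apply, Finset.sum_eq_single j] <;> simp +contextual

theorem diagMap_injective {b : Fin n → W} (hb : LinearIndependent ℝ b) :
    Function.Injective (diagMap b) := fun v w h => hb.fintypeLinearCombination_injective <| by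
  simpa [diagMap_apply, Fintype.linearCombination_apply] using LinearMap.congr_fun h 1

theorem finrank_map_evalAt_range_diagMap_le (b : Fin n → W) {k : ℕ} (v : Fin k → Fin n → ℝ) :
    Module.finrank ℝ ((LinearMap.range (diagMap b)).map (evalAt v)) ≤ n := by
  rw [← LinearMap.range_comp]
  simpa using LinearMap.finrank_range_le ((evalAt v).comp (diagMap b))

theorem characterSum_zero (A : Tableau n W) : characterSum A 0 = 0 := by
  have h : ∀ v : Fin 0 → Fin n → ℝ, Module.finrank ℝ (A.map (evalAt v)) = 0 := fun _ =>
    Module.finrank_zero_of_subsingleton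
  simp [characterSum, h]

theorem characterSum_range_diagMap {b : Fin n → W} (hb : LinearIndependent ℝ b) {k : ℕ}
    (hk : 1 ≤ k) : characterSum (LinearMap.range (diagMap b)) k = n := by
  have hbdd : BddAbove (range fun v : Fin k → Fin n → ℝ =>
      Module.finrank ℝ ((LinearMap.range (diagMap b)).map (evalAt v))) :=
    ⟨n, by rintro _ ⟨v, rfl⟩; exact finrank_map_evalAt_range_diagMap_le b v⟩
  refine le_antisymm (ciSup_le fun v => finrank_map_evalAt_range_diagMap_le b v)
    (le_trans (le_of_eq ?_) (le_ciSup hbdd fun _ _ => 1))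
  rw [← LinearMap.range_comp, LinearMap.finrank_range_of_inj]
  · simp
  · intro v w h
    refine hb.fintypeLinearCombination_injective ?_
    simpa [evalAt, diagMap_apply, Fintype.linearCombination_apply] using congrFun h ⟨0, hk⟩

theorem character_one_range_diagMap {b : Fin n → W} (hb : LinearIndependent ℝ b) :
    character (LinearMap.range (diagMap b)) 1 = n := by
  simp [character, characterSum_range_diagMap hb le_rfl, characterSum_zero]

theorem character_range_diagMap_of_two_le {b : Fin n → W} (hb : LinearIndependent ℝ b) {k : ℕ}
    (hk : 2 ≤ k) : character (LinearMap.range (diagMap b)) k = 0 := by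
  rw [character, characterSum_range_diagMap hb (by omega),
    characterSum_range_diagMap hb (by omega), Nat.sub_self]

/-- The linear map `l ↦ ((v, w) ↦ ∑ l_i v_i w_i b_i)`.  Its range is the prolongation of the
diagonal tableau. -/
def diagMap₂ (b : Fin n → W) :
    (Fin n → ℝ) →ₗ[ℝ] (Fin n → ℝ) →ₗ[ℝ] (Fin n → ℝ) →ₗ[ℝ] W where
  toFun l := (diagMap b).comp (LinearMap.mulLeft ℝ l)
  map_add' l l' := LinearMap.ext fun v => by simp [add_mul]
  map_smul' r l := LinearMap.ext fun v => by simp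

theorem diagMap₂_apply (b : Fin n → W) (l v : Fin n → ℝ) :
    diagMap₂ b l v = diagMap b (l * v) := rfl

theorem diagMap₂_injective {b : Fin n → W} (hb : LinearIndependent ℝ b) :
    Function.Injective (diagMap₂ b) := fun l l' h => by
  simpa using diagMap_injective hb (LinearMap.congr_fun h 1)

theorem prolongation_range_diagMap {b : Fin n → W} (hb : LinearIndependent ℝ b) :
    prolongation (LinearMap.range (diagMap b)) = LinearMap.range (diagMap₂ b) := by
  apply le_antisymm
  · rintro P ⟨hP, hsymm⟩
    choose c hc using fun i : Fin n => hP (Pi.single i 1)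
    have hoff : ∀ i j, i ≠ j → c i j = 0 := by
      intro i j hij
      have h := hsymm (Pi.single i 1) (Pi.single j 1)
      rw [← hc i, ← hc j, diagMap_single_right, diagMap_single_right] at h
      have hcomb : Fintype.linearCombination ℝ b (Pi.single j (c i j)) =
          Fintype.linearCombination ℝ b (Pi.single i (c j i)) := by
        simpa only [Fintype.linearCombination_apply_single] using h
      simpa [Pi.single_apply, hij.symm] using
        congrFun (hb.fintypeLinearCombination_injective hcomb) j
    refine ⟨fun i => c i i, (Pi.basisFun ℝ (Fin n)).ext fun i => ?_⟩
    rw [Pi.basisFun_apply, ← hc i, diagMap₂_apply]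
    congr 1
    funext j
    by_cases hij : i = j
    · subst hij; simp
    · simp [hoff i j hij, Ne.symm hij]
  · rintro _ ⟨l, rfl⟩
    refine ⟨fun v => ⟨_, rfl⟩, fun v w => ?_⟩
    simp only [diagMap₂_apply, diagMap_apply, Pi.mul_apply]
    exact Finset.sum_congr rfl fun i _ => by congr 1; ring

theorem finrank_prolongation_range_diagMap {b : Fin n → W} (hb : LinearIndependent ℝ b) :
    Module.finrank ℝ (prolongation (LinearMap.range (diagMap b))) = n := by
  rw [prolongation_range_diagMap hb, LinearMap.finrank_range_of_inj (diagMap₂_injective hb)]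
  simp

theorem cartanTest_range_diagMap {b : Fin n → W} (hb : LinearIndependent ℝ b) :
    CartanTest (LinearMap.range (diagMap b)) := by
  rw [CartanTest, finrank_prolongation_range_diagMap hb, Finset.sum_eq_single 1]
  · rw [character_one_range_diagMap hb, one_mul]
  · intro k hk hk1
    have hk2 : 2 ≤ k := by have := (Finset.mem_Icc.1 hk).1; omega
    rw [character_range_diagMap_of_two_le hb hk2, mul_zero]
  · intro h
    rw [character_one_range_diagMap hb, one_mul]
    by_contra hn
    exact h (Finset.mem_Icc.2 ⟨le_rfl, Nat.one_le_iff_ne_zero.2 hn⟩)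

end DiagonalTableaux

section JetSystems

variable {E : Type*} [NormedAddCommGroup E] [NormedSpace ℝ E]
  {M : Type*} [TopologicalSpace M] [ChartedSpace E M] {n : ℕ}

/-- The form `π_i = (du_{ii} - ∑ (T_j u_{ii}) dx_j) / a_i`, which is dual to the vertical field
`V_i` of a frame as in `IsJetFrameAt`. -/
noncomputable def verticalForm (x : Fin n → M → ℝ) (u₂ : Sym2 (Fin n) → M → ℝ) (q : M)
    (T : Fin n → VField E M) (a : Fin n → ℝ) (i : Fin n) :
    Module.Dual ℝ (TangentSpace 𝓘(ℝ, E) q) :=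
  (a i)⁻¹ • (dform (u₂ s(i, i)) q -
    ∑ j, dform (u₂ s(i, i)) q (T j q) • dform (x j) q)

theorem verticalForm_apply (x : Fin n → M → ℝ) (u₂ : Sym2 (Fin n) → M → ℝ) (q : M)
    (T : Fin n → VField E M) (a : Fin n → ℝ) (i : Fin n) (v : TangentSpace 𝓘(ℝ, E) q) :
    verticalForm x u₂ q T a i v = (a i)⁻¹ * (dform (u₂ s(i, i)) q v -
      ∑ j, dform (u₂ s(i, i)) q (T j q) * dform (x j) q v) := by
  simp only [verticalForm, LinearMap.smul_apply, LinearMap.sub_apply, smul_eq_mul]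
  rw [LinearMap.sum_apply]
  rfl

/-- The functions `x, u, u₁, u₂` map `U` to the second-order jet space in such a way that the
contact forms `du - ∑ u_i dx_i` and `du_i - ∑ u_{ij} dx_j` pull back to forms that vanish on `D`. -/
structure IsJetSubsystem (D : Distribution E M) (U : Set M) (x : Fin n → M → ℝ) (u : M → ℝ)
    (u₁ : Fin n → M → ℝ) (u₂ : Sym2 (Fin n) → M → ℝ) : Prop where
  isOpen : IsOpen U
  smooth_x : ∀ i, ContMDiffOn 𝓘(ℝ, E) 𝓘(ℝ, ℝ) ∞ (x i) U
  smooth_u : ContMDiffOn 𝓘(ℝ, E) 𝓘(ℝ, ℝ) ∞ u U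
  smooth_u₁ : ∀ i, ContMDiffOn 𝓘(ℝ, E) 𝓘(ℝ, ℝ) ∞ (u₁ i) U
  smooth_u₂ : ∀ s, ContMDiffOn 𝓘(ℝ, E) 𝓘(ℝ, ℝ) ∞ (u₂ s) U
  contact_of_mem : ∀ q ∈ U, ∀ v ∈ D q,
    dform u q v = ∑ i, u₁ i q * dform (x i) q v ∧
      ∀ i, dform (u₁ i) q v = ∑ j, u₂ s(i, j) q * dform (x j) q v

/-- Over `U`, the distribution `D` is the inverse image of the contact distribution, that is, the
common kernel of the pulled back contact forms `du - ∑ u_i dx_i` and `du_i - ∑ u_{ij} dx_j`. -/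
structure IsJetSystem (D : Distribution E M) (U : Set M) (x : Fin n → M → ℝ) (u : M → ℝ)
    (u₁ : Fin n → M → ℝ) (u₂ : Sym2 (Fin n) → M → ℝ) : Prop
    extends IsJetSubsystem D U x u u₁ u₂ where
  mem_of_contact : ∀ q ∈ U, ∀ v, dform u q v = ∑ i, u₁ i q * dform (x i) q v →
    (∀ i, dform (u₁ i) q v = ∑ j, u₂ s(i, j) q * dform (x j) q v) → v ∈ D q

variable {D : Distribution E M} {U : Set M} {x : Fin n → M → ℝ} {u : M → ℝ}
  {u₁ : Fin n → M → ℝ} {u₂ : Sym2 (Fin n) → M → ℝ} {q : M}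

theorem IsJetSystem.mem_iff (h : IsJetSystem D U x u u₁ u₂) (hq : q ∈ U)
    (v : TangentSpace 𝓘(ℝ, E) q) : v ∈ D q ↔
      dform u q v = ∑ i, u₁ i q * dform (x i) q v ∧
        ∀ i, dform (u₁ i) q v = ∑ j, u₂ s(i, j) q * dform (x j) q v :=
  ⟨h.contact_of_mem q hq v, fun hv => h.mem_of_contact q hq v hv.1 hv.2⟩

variable [IsManifold 𝓘(ℝ, E) ∞ M]

/-- A frame `T_i, V_i` of `D` near `q` with `dx_i (T_j) = δ_{ij}` and `dx_i (V_j) = 0`, such that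
`T_k u_{ij}` is symmetric in `j, k` and `V_k u_{ij} = 0` at `q`, apart from `V_i u_{ii} = a_i ≠ 0`.
The vectors `B_i` are dual to the `du_i` up to the factors `a_i`; they span a complement of `D` in
the kernel of `du - ∑ u_i dx_i`. -/
structure IsJetFrameAt (D : Distribution E M) (x : Fin n → M → ℝ) (u : M → ℝ)
    (u₁ : Fin n → M → ℝ) (u₂ : Sym2 (Fin n) → M → ℝ) (q : M) (T V : Fin n → VField E M)
    (B : Fin n → TangentSpace 𝓘(ℝ, E) q) (a : Fin n → ℝ) : Prop where
  section_T : ∀ i, IsLocalSection D q (T i)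
  section_V : ∀ i, IsLocalSection D q (V i)
  dx_T : ∀ i j, dform (x j) q (T i q) = if i = j then 1 else 0
  dx_V : ∀ i j, dform (x j) q (V i q) = 0
  mem_span_V : ∀ v ∈ D q, (∀ i, dform (x i) q v = 0) →
    v ∈ Submodule.span ℝ (range fun i => V i q)
  du₂_T : ∀ i j k, dform (u₂ s(i, j)) q (T k q) = dform (u₂ s(i, k)) q (T j q)
  du₂_V : ∀ s k, dform (u₂ s) q (V k q) = if s = s(k, k) then a k else 0
  a_ne : ∀ i, a i ≠ 0
  dx_B : ∀ i j, dform (x j) q (B i) = 0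
  du_B : ∀ i, dform u q (B i) = 0
  du₁_B : ∀ i j, dform (u₁ j) q (B i) = if i = j then a i else 0

variable {T V : Fin n → VField E M} {B : Fin n → TangentSpace 𝓘(ℝ, E) q} {a : Fin n → ℝ}

theorem IsLocalSection.mem {Y : VField E M} (hY : IsLocalSection D q Y) : Y q ∈ D q := by
  obtain ⟨V, -, hq, h⟩ := hY
  exact h.2 q hq

theorem IsLocalSection.exists_isSectionOn_pair {D' : Distribution E M} {Y Z : VField E M}
    (hY : IsLocalSection D q Y) (hZ : IsLocalSection D' q Z) (hU : IsOpen U) (hq : q ∈ U) :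
    ∃ V ⊆ U, IsOpen V ∧ q ∈ V ∧ IsSectionOn D V Y ∧ IsSectionOn D' V Z := by
  obtain ⟨V₁, ho₁, hq₁, hY₁, hY₂⟩ := hY
  obtain ⟨V₂, ho₂, hq₂, hZ₁, hZ₂⟩ := hZ
  exact ⟨U ∩ (V₁ ∩ V₂), inter_subset_left, hU.inter (ho₁.inter ho₂), ⟨hq, hq₁, hq₂⟩,
    ⟨hY₁.mono fun _ h => h.2.1, fun q hq => hY₂ q hq.2.1⟩,
    ⟨hZ₁.mono fun _ h => h.2.2, fun q hq => hZ₂ q hq.2.2⟩⟩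

theorem IsJetSubsystem.dform_u₁_bracket [CompleteSpace E] (h : IsJetSubsystem D U x u u₁ u₂)
    (hq : q ∈ U) {Y Z : VField E M} (hY : IsLocalSection D q Y) (hZ : IsLocalSection D q Z)
    (i : Fin n) :
    dform (u₁ i) q (bracket Y Z q) = ∑ j, u₂ s(i, j) q * dform (x j) q (bracket Y Z q) +
      ∑ j, (dform (u₂ s(i, j)) q (Y q) * dform (x j) q (Z q) -
        dform (u₂ s(i, j)) q (Z q) * dform (x j) q (Y q)) := by
  obtain ⟨V, hVU, hV, hqV, hYV, hZV⟩ := hY.exists_isSectionOn_pair hZ h.isOpen hq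
  exact dform_bracket_of_dform_eq_sum (a := fun j => u₂ s(i, j)) (x := x) hV hYV.1 hZV.1
    ((h.smooth_u₁ i).mono hVU) (fun j => (h.smooth_u₂ s(i, j)).mono hVU)
    (fun i => (h.smooth_x i).mono hVU)
    (fun q' hq' => (h.contact_of_mem q' (hVU hq') _ (hYV.2 q' hq')).2 i)
    (fun q' hq' => (h.contact_of_mem q' (hVU hq') _ (hZV.2 q' hq')).2 i) hqV

theorem IsJetSubsystem.dform_u_bracket [CompleteSpace E] (h : IsJetSubsystem D U x u u₁ u₂)
    (hq : q ∈ U) {Y Z : VField E M} (hY : IsLocalSection D q Y) (hZ : IsLocalSection D q Z) :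
    dform u q (bracket Y Z q) = ∑ i, u₁ i q * dform (x i) q (bracket Y Z q) := by
  have hwedge : ∑ j, (dform (u₁ j) q (Y q) * dform (x j) q (Z q) -
        dform (u₁ j) q (Z q) * dform (x j) q (Y q)) = 0 := by
    simp only [(h.contact_of_mem q hq _ hY.mem).2, (h.contact_of_mem q hq _ hZ.mem).2,
      Finset.sum_mul, Finset.sum_sub_distrib]
    rw [sub_eq_zero, Finset.sum_comm]
    refine Finset.sum_congr rfl fun i _ => Finset.sum_congr rfl fun j _ => ?_
    rw [Sym2.eq_swap]
    ring
  obtain ⟨V, hVU, hV, hqV, hYV, hZV⟩ := hY.exists_isSectionOn_pair hZ h.isOpen hq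
  rw [dform_bracket_of_dform_eq_sum (a := u₁) (x := x) hV hYV.1 hZV.1
    (h.smooth_u.mono hVU) (fun i => (h.smooth_u₁ i).mono hVU) (fun i => (h.smooth_x i).mono hVU)
    (fun q' hq' => (h.contact_of_mem q' (hVU hq') _ (hYV.2 q' hq')).1)
    (fun q' hq' => (h.contact_of_mem q' (hVU hq') _ (hZV.2 q' hq')).1) hqV, hwedge, add_zero]

namespace IsJetFrameAt

theorem verticalForm_V (hF : IsJetFrameAt D x u u₁ u₂ q T V B a)
    (i k : Fin n) : verticalForm x u₂ q T a i (V k q) = if i = k then 1 else 0 := by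
  rw [verticalForm_apply, hF.du₂_V]
  simp only [hF.dx_V, mul_zero, Finset.sum_const_zero, sub_zero]
  by_cases h : i = k
  · subst h; simp [hF.a_ne]
  · simp [h]

theorem verticalForm_T (hF : IsJetFrameAt D x u u₁ u₂ q T V B a)
    (i k : Fin n) : verticalForm x u₂ q T a i (T k q) = 0 := by
  rw [verticalForm_apply]
  simp [hF.dx_T]

theorem eq_sum (hF : IsJetFrameAt D x u u₁ u₂ q T V B a)
    {v : TangentSpace 𝓘(ℝ, E) q} (hv : v ∈ D q) :
    v = ∑ k, dform (x k) q v • T k q + ∑ k, verticalForm x u₂ q T a k v • V k q := by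
  set w := v - ∑ k, dform (x k) q v • T k q with hw
  have hwD : w ∈ D q := (D q).sub_mem hv
    ((D q).sum_mem fun k _ => (D q).smul_mem _ (hF.section_T k).mem)
  have hwx : ∀ i, dform (x i) q w = 0 := by
    intro i
    rw [hw, map_sub, map_sum]
    simp [hF.dx_T]
  obtain ⟨c, hc⟩ := (Submodule.mem_span_range_iff_exists_fun ℝ).1 (hF.mem_span_V w hwD hwx)
  have hform : ∀ k, verticalForm x u₂ q T a k v = c k := by
    intro k
    have hv_eq : v = ∑ k, dform (x k) q v • T k q + ∑ k, c k • V k q := by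
      rw [hc, hw]; abel
    rw [hv_eq, map_add, map_sum, map_sum]
    simp [hF.verticalForm_T, hF.verticalForm_V]
  simp only [hform, hc, hw]
  abel

theorem dform_u₂ (hF : IsJetFrameAt D x u u₁ u₂ q T V B a)
    {v : TangentSpace 𝓘(ℝ, E) q} (hv : v ∈ D q) (i j : Fin n) :
    dform (u₂ s(i, j)) q v = ∑ k, dform (x k) q v * dform (u₂ s(i, j)) q (T k q) +
      if i = j then verticalForm x u₂ q T a i v * a i else 0 := by
  conv_lhs => rw [hF.eq_sum hv]
  rw [map_add, map_sum, map_sum]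
  simp only [map_smul, smul_eq_mul, hF.du₂_V]
  congr 1
  by_cases h : i = j
  · subst h
    rw [Finset.sum_eq_single i]
    · simp
    · intro k _ hk
      simp [Ne.symm hk]
    · simp
  · rw [if_neg h]
    refine Finset.sum_eq_zero fun k _ => ?_
    rw [if_neg, mul_zero]
    simp only [Sym2.eq_iff, or_self, not_and]
    rintro rfl rfl
    exact h rfl

theorem dform_u₁_bracket [CompleteSpace E] (hF : IsJetFrameAt D x u u₁ u₂ q T V B a)
    (h : IsJetSystem D U x u u₁ u₂) (hq : q ∈ U)
    {Y Z : VField E M} (hY : IsLocalSection D q Y)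
    (hZ : IsLocalSection D q Z) (i : Fin n) :
    dform (u₁ i) q (bracket Y Z q) = ∑ j, u₂ s(i, j) q * dform (x j) q (bracket Y Z q) +
      a i * (verticalForm x u₂ q T a i (Y q) * dform (x i) q (Z q) -
        verticalForm x u₂ q T a i (Z q) * dform (x i) q (Y q)) := by
  rw [h.dform_u₁_bracket hq hY hZ i]
  congr 1
  simp only [hF.dform_u₂ hY.mem, hF.dform_u₂ hZ.mem, add_mul, Finset.sum_mul, ite_mul, zero_mul]
  have hsymm : ∑ j, ∑ k, dform (x k) q (Y q) * dform (u₂ s(i, j)) q (T k q) * dform (x j) q (Z q) =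
      ∑ j, ∑ k, dform (x k) q (Z q) * dform (u₂ s(i, j)) q (T k q) * dform (x j) q (Y q) := by
    rw [Finset.sum_comm]
    refine Finset.sum_congr rfl fun k _ => Finset.sum_congr rfl fun j _ => ?_
    rw [hF.du₂_T i j k]
    ring
  rw [Finset.sum_sub_distrib, Finset.sum_add_distrib, Finset.sum_add_distrib, hsymm]
  simp only [Finset.sum_ite_eq, Finset.mem_univ, if_true]
  ring

/-- The structure equations `dθ^i ≡ a_i π_i ∧ dx_i mod D^⊥`, with brackets in place of exterior
derivatives. -/
theorem mkQ_bracket [CompleteSpace E] (hF : IsJetFrameAt D x u u₁ u₂ q T V B a)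
    (h : IsJetSystem D U x u u₁ u₂) (hq : q ∈ U)
    {Y Z : VField E M} (hY : IsLocalSection D q Y) (hZ : IsLocalSection D q Z) :
    (D q).mkQ (bracket Y Z q) = ∑ i, (verticalForm x u₂ q T a i (Y q) * dform (x i) q (Z q) -
        verticalForm x u₂ q T a i (Z q) * dform (x i) q (Y q)) • (D q).mkQ (B i) := by
  simp only [← map_smul]
  rw [← map_sum, ← sub_eq_zero, ← map_sub, Submodule.mkQ_apply, Submodule.Quotient.mk_eq_zero,
    h.mem_iff hq]
  constructor
  · rw [map_sub, map_sum, h.dform_u_bracket hq hY hZ]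
    simp [hF.du_B, hF.dx_B]
  · intro i
    rw [map_sub, map_sum, hF.dform_u₁_bracket h hq hY hZ i]
    simp [hF.du₁_B, hF.dx_B]
    ring

theorem linearIndependent_mkQ (hF : IsJetFrameAt D x u u₁ u₂ q T V B a)
    (h : IsJetSystem D U x u u₁ u₂) (hq : q ∈ U) :
    LinearIndependent ℝ fun i => (D q).mkQ (B i) := by
  refine Fintype.linearIndependent_iff.2 fun c hc j => ?_
  simp only [← map_smul] at hc
  rw [← map_sum, Submodule.mkQ_apply, Submodule.Quotient.mk_eq_zero, h.mem_iff hq] at hc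
  have hj := hc.2 j
  rw [map_sum] at hj
  simpa [hF.du₁_B, hF.dx_B, hF.a_ne] using hj

theorem tableau_eq [CompleteSpace E] (hF : IsJetFrameAt D x u u₁ u₂ q T V B a)
    (h : IsJetSystem D U x u u₁ u₂) (hq : q ∈ U) : tableau D (fun i => dform (x i)) q =
    LinearMap.range (diagMap fun i => (D q).mkQ (B i)) := by
  apply le_antisymm
  · refine Submodule.span_le.2 ?_
    rintro b ⟨Y, hY, hYx, hb⟩
    refine ⟨fun i => verticalForm x u₂ q T a i (Y q), ?_⟩
    refine (Pi.basisFun ℝ (Fin n)).ext fun j => ?_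
    have hTj : (fun i => dform (x i) q (T j q)) = Pi.single j 1 := by
      funext i
      rw [hF.dx_T, Pi.single_apply]
      exact if_congr eq_comm rfl rfl
    rw [Pi.basisFun_apply, diagMap_single_right, ← hTj, hb _ (hF.section_T j),
      hF.mkQ_bracket h hq hY (hF.section_T j)]
    rw [Finset.sum_eq_single j] <;> simp +contextual [hF.dx_T, hYx, eq_comm]
  · rintro _ ⟨v, rfl⟩
    rw [LinearMap.pi_apply_eq_sum_univ (diagMap _) v]
    refine Submodule.sum_mem _ fun i _ => Submodule.smul_mem _ _ (Submodule.subset_span ?_)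
    refine ⟨V i, hF.section_V i, fun j => hF.dx_V i j, fun Z hZ => ?_⟩
    rw [hF.mkQ_bracket h hq (hF.section_V i) hZ, diagMap_apply]
    refine Finset.sum_congr rfl fun j _ => ?_
    rw [hF.verticalForm_V, hF.dx_V, mul_zero, sub_zero]
    by_cases hij : i = j <;> simp [hij, eq_comm]

theorem isInvolutiveAt [CompleteSpace E] (hF : IsJetFrameAt D x u u₁ u₂ q T V B a)
    (h : IsJetSystem D U x u u₁ u₂) (hq : q ∈ U) :
    IsInvolutiveAt D (fun i => dform (x i)) q := by
  refine ⟨⟨fun c => ⟨∑ k, c k • T k q, (D q).sum_mem fun k _ => (D q).smul_mem _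
      (hF.section_T k).mem, fun i => ?_⟩, fun Y Z hY hZ hYx hZx => ?_⟩,
    ⟨T, hF.section_T, hF.dx_T, fun i j => ?_⟩, ?_⟩
  · rw [map_sum]
    simp [hF.dx_T]
  · rw [← Submodule.Quotient.mk_eq_zero, ← Submodule.mkQ_apply, hF.mkQ_bracket h hq hY hZ]
    simp [hYx, hZx]
  · rw [← Submodule.Quotient.mk_eq_zero, ← Submodule.mkQ_apply,
      hF.mkQ_bracket h hq (hF.section_T i) (hF.section_T j)]
    simp [hF.verticalForm_T]
  · rw [hF.tableau_eq h hq]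
    exact cartanTest_range_diagMap (hF.linearIndependent_mkQ h hq)

theorem character_one [CompleteSpace E] (hF : IsJetFrameAt D x u u₁ u₂ q T V B a)
    (h : IsJetSystem D U x u u₁ u₂) (hq : q ∈ U) :
    character (tableau D (fun i => dform (x i)) q) 1 = n := by
  rw [hF.tableau_eq h hq]
  exact character_one_range_diagMap (hF.linearIndependent_mkQ h hq)

theorem character_of_two_le [CompleteSpace E] (hF : IsJetFrameAt D x u u₁ u₂ q T V B a)
    (h : IsJetSystem D U x u u₁ u₂) (hq : q ∈ U)
    {k : ℕ} (hk : 2 ≤ k) :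
    character (tableau D (fun i => dform (x i)) q) k = 0 := by
  rw [hF.tableau_eq h hq]
  exact character_range_diagMap_of_two_le (hF.linearIndependent_mkQ h hq) hk

end IsJetFrameAt

end JetSystems

section Coordinates

variable {E : Type*} [NormedAddCommGroup E] [NormedSpace ℝ E]
  {M : Type*} [TopologicalSpace M] [ChartedSpace E M] {n : ℕ}

theorem dform_clm_comp {F : Type*} [NormedAddCommGroup F] [NormedSpace ℝ F] {f : M → F} {q : M}
    (hf : MDifferentiableAt 𝓘(ℝ, E) 𝓘(ℝ, F) f q) (L : F →L[ℝ] ℝ) (v : TangentSpace 𝓘(ℝ, E) q) :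
    dform (fun q' => L (f q')) q v = L (mfderiv 𝓘(ℝ, E) 𝓘(ℝ, F) f q v) := by
  have h := mfderiv_comp q (L.mdifferentiableAt (x := f q)) hf
  rw [L.mfderiv_eq] at h
  exact congrArg (fun A : E →L[ℝ] ℝ => A v) h

theorem isInvertible_mfderiv_coord (χ : CoordSystem n E M) {q : M} (hq : q ∈ χ.source) :
    (mfderiv 𝓘(ℝ, E) 𝓘(ℝ, Coord n) χ q).IsInvertible :=
  ⟨(χ.isLocalDiffeomorphAt _ _ _ hq).mfderivToContinuousLinearEquiv (by simp), rfl⟩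

theorem mfderiv_coordField (χ : CoordSystem n E M) {q : M} (hq : q ∈ χ.source) (c : Coord n) :
    mfderiv 𝓘(ℝ, E) 𝓘(ℝ, Coord n) χ q (coordField χ c q) = c := by
  obtain ⟨L, hL⟩ := isInvertible_mfderiv_coord χ hq
  have hfield : coordField χ c q = L.symm c := by
    change (mfderiv 𝓘(ℝ, E) 𝓘(ℝ, Coord n) χ q).inverse c = L.symm c
    rw [← hL, ContinuousLinearMap.inverse_equiv]
    rfl
  rw [hfield, ← hL]
  exact L.apply_symm_apply c

theorem contMDiffOn_xfun (χ : CoordSystem n E M) (i : Fin n) :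
    ContMDiffOn 𝓘(ℝ, E) 𝓘(ℝ, ℝ) ∞ (xfun χ i) χ.source :=
  ((ContinuousLinearMap.proj (R := ℝ) (φ := fun _ : Fin n => ℝ) i).comp
    (ContinuousLinearMap.fst ℝ _ _)).contMDiff.comp_contMDiffOn χ.contMDiffOn

theorem dform_xfun_coordField (χ : CoordSystem n E M) {q : M} (hq : q ∈ χ.source) (c : Coord n)
    (i : Fin n) : dform (xfun χ i) q (coordField χ c q) = c.1 i := by
  have h := dform_clm_comp (χ.mdifferentiableAt (by simp) hq)
    ((ContinuousLinearMap.proj i).comp (ContinuousLinearMap.fst ℝ _ _)) (coordField χ c q)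
  rw [mfderiv_coordField χ hq] at h
  exact h

theorem dform_xfun_ddu (χ : CoordSystem n E M) {q : M} (hq : q ∈ χ.source) (i j : Fin n) :
    dform (xfun χ j) q (ddu χ i q) = 0 := dform_xfun_coordField χ hq _ j

theorem calA_eq_span (χ : CoordSystem n E M) (X : Fin n → VField E M) (q : M) :
    calA χ X q = Submodule.span ℝ (range (Sum.elim (fun i => ddu χ i q)
      (fun i => bracket (ddu χ i) (X i) q))) := by
  rw [calA, Sum.elim_range]

theorem mem_calA_iff_exists (χ : CoordSystem n E M) (X : Fin n → VField E M) {q : M}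
    {v : TangentSpace 𝓘(ℝ, E) q} : v ∈ calA χ X q ↔ ∃ b c : Fin n → ℝ,
      v = ∑ k, b k • ddu χ k q + ∑ k, c k • bracket (ddu χ k) (X k) q := by
  rw [calA_eq_span, Submodule.mem_span_range_iff_exists_fun]
  constructor
  · rintro ⟨c, rfl⟩
    exact ⟨fun k => c (Sum.inl k), fun k => c (Sum.inr k), by rw [Fintype.sum_sum_type]; rfl⟩
  · rintro ⟨b, c, rfl⟩
    exact ⟨Sum.elim b c, by rw [Fintype.sum_sum_type]; rfl⟩

theorem dform_eq_zero_of_mem_span_ddu {χ : CoordSystem n E M} {f : M → ℝ} {q : M}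
    (hf : ∀ i, dform f q (ddu χ i q) = 0)
    {v : TangentSpace 𝓘(ℝ, E) q} (hv : v ∈ Submodule.span ℝ (range fun i => ddu χ i q)) :
    dform f q v = 0 := by
  obtain ⟨c, rfl⟩ := (Submodule.mem_span_range_iff_exists_fun ℝ).1 hv
  rw [map_sum]
  simp [hf]

theorem dform_p_X (X : Fin n → VField E M) (p : M → ℝ) (q : M) (i : Fin n) :
    dform p q (X i q) = p1 X p i q := rfl

theorem dform_p1_X (X : Fin n → VField E M) (p : M → ℝ) (q : M) (i j : Fin n) :
    dform (p1 X p i) q (X j q) = p2 X p i j q := rfl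

variable [IsManifold 𝓘(ℝ, E) ∞ M]

theorem smoothOn_coordField [CompleteSpace E] (χ : CoordSystem n E M) (c : Coord n) :
    SmoothOn (coordField χ c) χ.source := by
  intro q hq
  refine ContMDiffAt.contMDiffWithinAt ?_
  refine ContMDiffAt.mpullback_vectorField_preimage (n := ∞) ?_
    (χ.contMDiffOn.contMDiffAt (χ.open_source.mem_nhds hq)) (isInvertible_mfderiv_coord χ hq)
    (by simp)
  exact contMDiffAt_vectorSpace_iff_contDiffAt.2 contDiffAt_const

theorem smoothOn_ddu [CompleteSpace E] (χ : CoordSystem n E M) (i : Fin n) :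
    SmoothOn (ddu χ i) χ.source :=
  smoothOn_coordField χ _

end Coordinates

section Invariants

variable {E : Type*} [NormedAddCommGroup E] [NormedSpace ℝ E]
  {M : Type*} [TopologicalSpace M] [ChartedSpace E M] [IsManifold 𝓘(ℝ, E) ∞ M] {n : ℕ}

/-- Over the domain of the adapted coordinates `χ`, the brackets `[H_i, H_j]`, `i ≠ j`, lie in `H`
and the functions `x_1, …, x_n, p` span the invariants of `𝒜`. -/
structure HasInvariants (Hs : Fin n → Distribution E M) (χ : CoordSystem n E M)
    (X : Fin n → VField E M) (p : M → ℝ) : Prop where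
  dim_eq : Module.finrank ℝ E = 3 * n + 1
  bracket_ne : ∀ i j, i ≠ j → ∀ q ∈ χ.source, ∀ Y Z : VField E M,
    IsLocalSection (Hs i) q Y → IsLocalSection (Hs j) q Z → bracket Y Z q ∈ total Hs q
  adapted : IsAdapted Hs χ X
  invariants : SpansInvariants χ X p

/-- The functions `X_j p_i`, which are symmetric in `i` and `j`, as functions of the unordered pair
`{i, j}`; they are the `u_{ij}`-components of `Φ`. -/
noncomputable def pSym (X : Fin n → VField E M) (p : M → ℝ) (s : Sym2 (Fin n)) : M → ℝ :=
  p2 X p s.inf s.sup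

namespace HasInvariants

variable {Hs : Fin n → Distribution E M} {χ : CoordSystem n E M} {X : Fin n → VField E M}
  {p : M → ℝ} {q : M}

theorem finiteDimensional (h : HasInvariants Hs χ X p) : FiniteDimensional ℝ E :=
  FiniteDimensional.of_finrank_pos (by rw [h.dim_eq]; omega)

theorem dform_xfun_X (h : HasInvariants Hs χ X p) (hq : q ∈ χ.source) (i j : Fin n) :
    dform (xfun χ j) q (X i q) = if i = j then 1 else 0 := by
  obtain ⟨ρ, σ, hX⟩ := h.adapted.form i q hq
  have hddy : ∀ a, dform (xfun χ j) q (ddy χ a q) = 0 := fun a => dform_xfun_coordField χ hq _ j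
  have hddx : dform (xfun χ j) q (ddx χ i q) = if i = j then 1 else 0 := by
    refine (dform_xfun_coordField χ hq _ j).trans ?_
    simp [Pi.single_apply, eq_comm]
  rw [hX, map_add, map_add, map_sum, map_sum]
  simp [hddy, hddx, dform_xfun_ddu χ hq]

theorem mem_calA (h : HasInvariants Hs χ X p) (hq : q ∈ χ.source) (v : TangentSpace 𝓘(ℝ, E) q) :
    v ∈ calA χ X q ↔ (∀ i, dform (xfun χ i) q v = 0) ∧ dform p q v = 0 := by
  rw [← Subspace.dualAnnihilator_dualCoannihilator_eq (W := calA χ X q), ← h.invariants.2 q hq,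
    Submodule.mem_dualCoannihilator]
  constructor
  · intro hv
    exact ⟨fun i => hv _ (Submodule.subset_span (Or.inl ⟨i, rfl⟩)),
      hv _ (Submodule.subset_span (Or.inr rfl))⟩
  · rintro ⟨hx, hp⟩ φ hφ
    induction hφ using Submodule.span_induction with
    | mem φ hφ =>
      rcases hφ with ⟨i, rfl⟩ | rfl
      exacts [hx i, hp]
    | zero => rfl
    | add φ ψ _ _ hφ hψ => rw [LinearMap.add_apply, hφ, hψ, add_zero]
    | smul c φ _ hφ => rw [LinearMap.smul_apply, hφ, smul_zero]

/-- There are `2n` generators of `𝒜` and `n + 1` generators of its annihilator, on a space of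
dimension `3n + 1 = 2n + (n + 1)`. -/
theorem finrank_calA (h : HasInvariants Hs χ X p) (hq : q ∈ χ.source) :
    Module.finrank ℝ (calA χ X q) = 2 * n := by
  have := h.finiteDimensional
  have : FiniteDimensional ℝ (TangentSpace 𝓘(ℝ, E) q) := inferInstanceAs (FiniteDimensional ℝ E)
  have hdim : Module.finrank ℝ (TangentSpace 𝓘(ℝ, E) q) = 3 * n + 1 := h.dim_eq
  have hsum := Subspace.finrank_add_finrank_dualAnnihilator_eq (calA χ X q)
  have hann : Module.finrank ℝ (calA χ X q).dualAnnihilator ≤ n + 1 := by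
    have hrange : range (fun i => dform (E := E) (xfun χ i) q) ∪ {dform p q} =
        range (Sum.elim (fun i => dform (E := E) (xfun χ i) q) (fun _ : Unit => dform p q)) := by
      rw [Sum.elim_range, range_const]
    rw [← h.invariants.2 q hq, hrange]
    exact (finrank_range_le_card _).trans (by simp)
  have hle : Module.finrank ℝ (calA χ X q) ≤ 2 * n := by
    rw [calA_eq_span]
    exact (finrank_range_le_card _).trans (by simp [two_mul])
  omega

theorem linearIndependent_calA (h : HasInvariants Hs χ X p) (hq : q ∈ χ.source) :
    LinearIndependent ℝ (Sum.elim (fun i => ddu χ i q)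
      (fun i => bracket (ddu χ i) (X i) q)) := by
  rw [linearIndependent_iff_card_eq_finrank_span, Set.finrank, ← calA_eq_span, h.finrank_calA hq]
  simp [two_mul]

theorem total_eq (h : HasInvariants Hs χ X p) (hq : q ∈ χ.source) : total Hs q =
    Submodule.span ℝ (range fun i => X i q) ⊔ Submodule.span ℝ (range fun i => ddu χ i q) := by
  have hHs : ∀ i, Hs i q = Submodule.span ℝ {X i q} ⊔ Submodule.span ℝ {ddu χ i q} := fun i => by
    rw [(h.adapted.basis i q hq).2, Submodule.span_insert]
  simp only [total, hHs, iSup_sup_eq, Submodule.span_range_eq_iSup]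

theorem mem_span_ddu (h : HasInvariants Hs χ X p) (hq : q ∈ χ.source)
    {v : TangentSpace 𝓘(ℝ, E) q} (hv : v ∈ total Hs q) (hx : ∀ i, dform (xfun χ i) q v = 0) :
    v ∈ Submodule.span ℝ (range fun i => ddu χ i q) := by
  rw [h.total_eq hq] at hv
  obtain ⟨y, hy, z, hz, rfl⟩ := Submodule.mem_sup.1 hv
  obtain ⟨b, rfl⟩ := (Submodule.mem_span_range_iff_exists_fun ℝ).1 hy
  obtain ⟨c, rfl⟩ := (Submodule.mem_span_range_iff_exists_fun ℝ).1 hz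
  have hb : ∀ i, b i = 0 := by
    intro i
    have hxi := hx i
    rw [map_add, map_sum, map_sum] at hxi
    simpa [h.dform_xfun_X hq, dform_xfun_ddu χ hq] using hxi
  simpa [hb] using hz

theorem isSectionOn_X (h : HasInvariants Hs χ X p) (i : Fin n) :
    IsSectionOn (Hs i) χ.source (X i) :=
  ⟨h.adapted.smooth i, fun q hq => by
    rw [(h.adapted.basis i q hq).2]
    exact Submodule.subset_span (by simp)⟩

theorem X_mem (h : HasInvariants Hs χ X p) (hq : q ∈ χ.source) (i : Fin n) :
    X i q ∈ total Hs q := Submodule.mem_iSup_of_mem i ((h.isSectionOn_X i).2 q hq)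

theorem isLocalSection_X (h : HasInvariants Hs χ X p) (hq : q ∈ χ.source) (i : Fin n) :
    IsLocalSection (total Hs) q (X i) :=
  ⟨χ.source, χ.open_source, hq, h.adapted.smooth i, fun _ hq' => h.X_mem hq' i⟩

theorem contMDiffOn_p1 (h : HasInvariants Hs χ X p) (i : Fin n) :
    ContMDiffOn 𝓘(ℝ, E) 𝓘(ℝ, ℝ) ∞ (p1 X p i) χ.source :=
  (h.adapted.smooth i).contMDiffOn_der χ.open_source h.invariants.1

theorem contMDiffOn_p2 (h : HasInvariants Hs χ X p) (i j : Fin n) :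
    ContMDiffOn 𝓘(ℝ, E) 𝓘(ℝ, ℝ) ∞ (p2 X p i j) χ.source :=
  (h.adapted.smooth j).contMDiffOn_der χ.open_source (h.contMDiffOn_p1 i)

theorem dform_p_ddu (h : HasInvariants Hs χ X p) (hq : q ∈ χ.source) (i : Fin n) :
    dform p q (ddu χ i q) = 0 :=
  ((h.mem_calA hq _).1 (Submodule.subset_span (Or.inl ⟨i, rfl⟩))).2

theorem dform_p_bracket_ddu_X (h : HasInvariants Hs χ X p) (hq : q ∈ χ.source) (i : Fin n) :
    dform p q (bracket (ddu χ i) (X i) q) = 0 :=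
  ((h.mem_calA hq _).1 (Submodule.subset_span (Or.inr ⟨i, rfl⟩))).2

theorem dform_xfun_bracket_ddu_X (h : HasInvariants Hs χ X p) (hq : q ∈ χ.source)
    (i j : Fin n) : dform (xfun χ j) q (bracket (ddu χ i) (X i) q) = 0 :=
  ((h.mem_calA hq _).1 (Submodule.subset_span (Or.inr ⟨i, rfl⟩))).1 j

theorem sub_sum_smul_X_mem_calA (h : HasInvariants Hs χ X p) (hq : q ∈ χ.source)
    {v : TangentSpace 𝓘(ℝ, E) q}
    (hv : dform p q v = ∑ i, p1 X p i q * dform (xfun χ i) q v) :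
    v - ∑ k, dform (xfun χ k) q v • X k q ∈ calA χ X q := by
  refine (h.mem_calA hq _).2 ⟨fun i => ?_, ?_⟩
  · rw [map_sub, map_sum]
    simp [h.dform_xfun_X hq]
  · rw [map_sub, map_sum, hv]
    simp [dform_p_X, mul_comm]

variable [CompleteSpace E]

theorem isIntegrableOn_calA (h : HasInvariants Hs χ X p) :
    IsIntegrableOn (calA χ X) χ.source := by
  intro q hq Y Z hY hZ
  obtain ⟨V, hVU, hV, hqV, hYV, hZV⟩ := hY.exists_isSectionOn_pair hZ χ.open_source hq
  refine (h.mem_calA hq _).2 ⟨fun i => ?_, ?_⟩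
  · exact dform_bracket_of_const hV hYV.1 hZV.1 ((contMDiffOn_xfun χ i).mono hVU)
      (fun q' hq' => ((h.mem_calA (hVU hq') _).1 (hYV.2 q' hq')).1 i)
      (fun q' hq' => ((h.mem_calA (hVU hq') _).1 (hZV.2 q' hq')).1 i) hqV
  · exact dform_bracket_of_const hV hYV.1 hZV.1 (h.invariants.1.mono hVU)
      (fun q' hq' => ((h.mem_calA (hVU hq') _).1 (hYV.2 q' hq')).2)
      (fun q' hq' => ((h.mem_calA (hVU hq') _).1 (hZV.2 q' hq')).2) hqV

theorem isSectionOn_ddu (h : HasInvariants Hs χ X p) (i : Fin n) :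
    IsSectionOn (Hs i) χ.source (ddu χ i) :=
  ⟨smoothOn_ddu χ i, fun q hq => by
    rw [(h.adapted.basis i q hq).2]
    exact Submodule.subset_span (by simp)⟩

theorem ddu_mem (h : HasInvariants Hs χ X p) (hq : q ∈ χ.source) (i : Fin n) :
    ddu χ i q ∈ total Hs q := Submodule.mem_iSup_of_mem i ((h.isSectionOn_ddu i).2 q hq)

theorem isLocalSection_ddu (h : HasInvariants Hs χ X p) (hq : q ∈ χ.source) (i : Fin n) :
    IsLocalSection (total Hs) q (ddu χ i) :=
  ⟨χ.source, χ.open_source, hq, smoothOn_ddu χ i, fun _ hq' => h.ddu_mem hq' i⟩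

/-- Such a bracket lies in `H` because `i ≠ j`, and it is annihilated by the `dx_k`. -/
theorem bracket_mem_span_ddu (h : HasInvariants Hs χ X p) (hq : q ∈ χ.source) {i j : Fin n}
    (hij : i ≠ j) {Y Z : VField E M} (hY : IsSectionOn (Hs i) χ.source Y)
    (hZ : IsSectionOn (Hs j) χ.source Z) {c c' : Fin n → ℝ}
    (hYx : ∀ k, ∀ q ∈ χ.source, dform (xfun χ k) q (Y q) = c k)
    (hZx : ∀ k, ∀ q ∈ χ.source, dform (xfun χ k) q (Z q) = c' k) :
    bracket Y Z q ∈ Submodule.span ℝ (range fun i => ddu χ i q) :=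
  h.mem_span_ddu hq
    (h.bracket_ne i j hij q hq Y Z ⟨_, χ.open_source, hq, hY⟩ ⟨_, χ.open_source, hq, hZ⟩)
    fun k => dform_bracket_of_const χ.open_source hY.1 hZ.1 (contMDiffOn_xfun χ k)
      (hYx k) (hZx k) hq

theorem bracket_ddu_X_mem (h : HasInvariants Hs χ X p) (hq : q ∈ χ.source) {i j : Fin n}
    (hij : i ≠ j) :
    bracket (ddu χ i) (X j) q ∈ Submodule.span ℝ (range fun i => ddu χ i q) :=
  h.bracket_mem_span_ddu hq hij (h.isSectionOn_ddu i) (h.isSectionOn_X j)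
    (fun k _ hq' => dform_xfun_ddu χ hq' i k) fun k _ hq' => h.dform_xfun_X hq' j k

theorem bracket_X_X_mem (h : HasInvariants Hs χ X p) (hq : q ∈ χ.source) (i j : Fin n) :
    bracket (X i) (X j) q ∈ Submodule.span ℝ (range fun i => ddu χ i q) := by
  by_cases hij : i = j
  · subst hij
    have hzero : bracket (X i) (X i) q = 0 := by simp [bracket]
    rw [hzero]
    exact Submodule.zero_mem _
  · exact h.bracket_mem_span_ddu hq hij (h.isSectionOn_X i) (h.isSectionOn_X j)
      (fun k _ hq' => h.dform_xfun_X hq' i k) fun k _ hq' => h.dform_xfun_X hq' j k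

theorem der_X_comm (h : HasInvariants Hs χ X p) (hq : q ∈ χ.source) {f : M → ℝ}
    (hf : ContMDiffOn 𝓘(ℝ, E) 𝓘(ℝ, ℝ) ∞ f χ.source)
    (hfu : ∀ k, dform f q (ddu χ k q) = 0) (i j : Fin n) :
    der (X i) (der (X j) f) q = der (X j) (der (X i) f) q := by
  have hbracket := der_bracket χ.open_source (h.adapted.smooth i) (h.adapted.smooth j) hf hq
  have hzero : der (bracket (X i) (X j)) f q = 0 :=
    dform_eq_zero_of_mem_span_ddu hfu (h.bracket_X_X_mem hq i j)
  exact sub_eq_zero.1 (hbracket.symm.trans hzero)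

theorem p2_comm (h : HasInvariants Hs χ X p) (hq : q ∈ χ.source) (i j : Fin n) :
    p2 X p i j q = p2 X p j i q :=
  h.der_X_comm hq h.invariants.1 (h.dform_p_ddu hq) j i

theorem pSym_eq (h : HasInvariants Hs χ X p) (hq : q ∈ χ.source) (i j : Fin n) :
    pSym X p s(i, j) q = p2 X p i j q := by
  rcases le_total i j with hij | hij
  · simp [pSym, hij]
  · simp only [pSym, Sym2.inf_mk, Sym2.sup_mk, inf_eq_right.2 hij, sup_eq_left.2 hij]
    exact h.p2_comm hq j i

theorem dform_p2_comm (h : HasInvariants Hs χ X p) (hq : q ∈ χ.source) (i j : Fin n) :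
    dform (E := E) (p2 X p i j) q = dform (p2 X p j i) q :=
  dform_congr (by filter_upwards [χ.open_source.mem_nhds hq] with q' hq' using h.p2_comm hq' i j)

theorem dform_pSym (h : HasInvariants Hs χ X p) (hq : q ∈ χ.source) (i j : Fin n) :
    dform (E := E) (pSym X p s(i, j)) q = dform (p2 X p i j) q :=
  dform_congr (by filter_upwards [χ.open_source.mem_nhds hq] with q' hq' using h.pSym_eq hq' i j)

theorem dform_p1_ddu (h : HasInvariants Hs χ X p) (hq : q ∈ χ.source) (i k : Fin n) :
    dform (p1 X p i) q (ddu χ k q) = 0 := by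
  refine (dform_bracket_of_left_const χ.open_source (smoothOn_ddu χ k) (h.adapted.smooth i)
    h.invariants.1 (fun _ hq' => h.dform_p_ddu hq' k) hq).symm.trans ?_
  by_cases hki : k = i
  · subst hki
    exact h.dform_p_bracket_ddu_X hq k
  · exact dform_eq_zero_of_mem_span_ddu (h.dform_p_ddu hq) (h.bracket_ddu_X_mem hq hki)

theorem dform_p2_ddu (h : HasInvariants Hs χ X p) (hq : q ∈ χ.source) (i j k : Fin n) :
    dform (p2 X p i j) q (ddu χ k q) = dform (p1 X p i) q (bracket (ddu χ k) (X j) q) :=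
  (dform_bracket_of_left_const χ.open_source (smoothOn_ddu χ k) (h.adapted.smooth j)
    (h.contMDiffOn_p1 i) (fun _ hq' => h.dform_p1_ddu hq' i k) hq).symm

theorem dform_p2_ddu_of_ne (h : HasInvariants Hs χ X p) (hq : q ∈ χ.source) {i j k : Fin n}
    (hkj : k ≠ j) : dform (p2 X p i j) q (ddu χ k q) = 0 := by
  rw [h.dform_p2_ddu hq]
  exact dform_eq_zero_of_mem_span_ddu (h.dform_p1_ddu hq i) (h.bracket_ddu_X_mem hq hkj)

theorem dform_p2_X_comm (h : HasInvariants Hs χ X p) (hq : q ∈ χ.source) (i j k : Fin n) :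
    dform (p2 X p i j) q (X k q) = dform (p2 X p i k) q (X j q) :=
  h.der_X_comm hq (h.contMDiffOn_p1 i) (h.dform_p1_ddu hq i) k j

end HasInvariants

end Invariants

section Invariants

variable {E : Type*} [NormedAddCommGroup E] [NormedSpace ℝ E]
  {M : Type*} [TopologicalSpace M] [ChartedSpace E M] [IsManifold 𝓘(ℝ, E) ∞ M] {n : ℕ}

/-- The functions `a_i = [∂/∂u_i, X_i] p_i`, which agree with `∂p_{ii}/∂u_i`. -/
noncomputable def verticalCoeff (χ : CoordSystem n E M) (X : Fin n → VField E M) (p : M → ℝ)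
    (i : Fin n) : M → ℝ :=
  der (bracket (ddu χ i) (X i)) (p1 X p i)

namespace HasInvariants

variable {Hs : Fin n → Distribution E M} {χ : CoordSystem n E M} {X : Fin n → VField E M}
  {p : M → ℝ} {q : M} [CompleteSpace E]

theorem smoothOn_bracket_ddu_X (h : HasInvariants Hs χ X p) (i : Fin n) :
    SmoothOn (bracket (ddu χ i) (X i)) χ.source :=
  (smoothOn_ddu χ i).bracket χ.open_source (h.adapted.smooth i)

theorem contMDiffOn_verticalCoeff (h : HasInvariants Hs χ X p) (i : Fin n) :
    ContMDiffOn 𝓘(ℝ, E) 𝓘(ℝ, ℝ) ∞ (verticalCoeff χ X p i) χ.source :=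
  (h.smoothOn_bracket_ddu_X i).contMDiffOn_der χ.open_source (h.contMDiffOn_p1 i)

theorem dform_p1_bracket_ddu_X (h : HasInvariants Hs χ X p) (hq : q ∈ χ.source) (i j : Fin n) :
    dform (p1 X p j) q (bracket (ddu χ i) (X i) q) =
      if i = j then verticalCoeff χ X p i q else 0 := by
  by_cases hij : i = j
  · subst hij; rw [if_pos rfl]; rfl
  · rw [if_neg hij, ← h.dform_p2_ddu hq, h.dform_p2_comm hq, h.dform_p2_ddu_of_ne hq hij]

theorem dform_pSym_ddu (h : HasInvariants Hs χ X p) (hq : q ∈ χ.source) (s : Sym2 (Fin n))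
    (k : Fin n) :
    dform (pSym X p s) q (ddu χ k q) = if s = s(k, k) then verticalCoeff χ X p k q else 0 := by
  induction s using Sym2.ind with
  | _ i j =>
    rw [h.dform_pSym hq]
    by_cases hkj : k = j
    · subst hkj
      rw [h.dform_p2_ddu hq, h.dform_p1_bracket_ddu_X hq]
      exact if_congr (by simp [eq_comm]) rfl rfl
    · rw [h.dform_p2_ddu_of_ne hq hkj, if_neg]
      simp only [Sym2.eq_iff, or_self, not_and]
      exact fun _ hj => hkj hj.symm

theorem isJetSubsystem (h : HasInvariants Hs χ X p) :
    IsJetSubsystem (total Hs) χ.source (xfun χ) p (p1 X p) (pSym X p) where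
  isOpen := χ.open_source
  smooth_x := contMDiffOn_xfun χ
  smooth_u := h.invariants.1
  smooth_u₁ := h.contMDiffOn_p1
  smooth_u₂ _ := h.contMDiffOn_p2 _ _
  contact_of_mem q hq v hv := by
    rw [h.total_eq hq] at hv
    obtain ⟨y, hy, z, hz, rfl⟩ := Submodule.mem_sup.1 hv
    obtain ⟨b, rfl⟩ := (Submodule.mem_span_range_iff_exists_fun ℝ).1 hy
    obtain ⟨c, rfl⟩ := (Submodule.mem_span_range_iff_exists_fun ℝ).1 hz
    constructor
    · simp only [map_add, map_sum]
      simp [dform_xfun_ddu χ hq, h.dform_xfun_X hq, h.dform_p_ddu hq, dform_p_X, mul_comm]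
    · intro i
      simp only [map_add, map_sum]
      simp [dform_xfun_ddu χ hq, h.dform_xfun_X hq, h.dform_p1_ddu hq, dform_p1_X,
        h.pSym_eq hq, mul_comm]

theorem bracket_ddu_X_mem_derived (h : HasInvariants Hs χ X p) (hq : q ∈ χ.source)
    (i : Fin n) : bracket (ddu χ i) (X i) q ∈ derived (total Hs) q :=
  Submodule.mem_sup_right (Submodule.subset_span
    ⟨_, _, h.isLocalSection_ddu hq i, h.isLocalSection_X hq i, rfl⟩)

theorem calA_le_derived (h : HasInvariants Hs χ X p) (hq : q ∈ χ.source) :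
    calA χ X q ≤ derived (total Hs) q := by
  refine Submodule.span_le.2 ?_
  rintro _ (⟨i, rfl⟩ | ⟨i, rfl⟩)
  · exact Submodule.mem_sup_left (h.ddu_mem hq i)
  · exact h.bracket_ddu_X_mem_derived hq i

theorem mem_derived_iff (h : HasInvariants Hs χ X p) (hq : q ∈ χ.source)
    (v : TangentSpace 𝓘(ℝ, E) q) :
    v ∈ derived (total Hs) q ↔ dform p q v = ∑ i, p1 X p i q * dform (xfun χ i) q v := by
  constructor
  · intro hv
    obtain ⟨w, hw, w', hw', rfl⟩ := Submodule.mem_sup.1 hv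
    have hbracket : dform p q w' = ∑ i, p1 X p i q * dform (xfun χ i) q w' := by
      clear hv
      induction hw' using Submodule.span_induction with
      | mem w hw =>
        obtain ⟨Y, Z, hY, hZ, rfl⟩ := hw
        exact h.isJetSubsystem.dform_u_bracket hq hY hZ
      | zero => simp
      | add w w' _ _ hw hw' => simp [hw, hw', mul_add, Finset.sum_add_distrib]
      | smul c w _ hw => simp [hw, Finset.mul_sum, mul_left_comm]
    simp [(h.isJetSubsystem.contact_of_mem q hq w hw).1, hbracket, mul_add,
      Finset.sum_add_distrib]
  · intro hv
    rw [← sub_add_cancel v (∑ k, dform (xfun χ k) q v • X k q)]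
    exact Submodule.add_mem _ (h.calA_le_derived hq (h.sub_sum_smul_X_mem_calA hq hv))
      (Submodule.sum_mem _ fun k _ =>
        Submodule.smul_mem _ _ (Submodule.mem_sup_left (h.X_mem hq k)))

/-- If `a_i(q) = 0`, then `[∂/∂u_i, X_i]` annihilates all `dp_j` at `q`, so its value at `q` is
Cauchy characteristic for `H⁽¹⁾` and lies in the span of the `∂/∂u_k`.  This contradicts
`rank 𝒜 = 2n`. -/
theorem verticalCoeff_ne_zero (h : HasInvariants Hs χ X p) (hq : q ∈ χ.source) (i : Fin n) :
    verticalCoeff χ X p i q ≠ 0 := by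
  intro hcoeff
  have hp₁ : ∀ j, dform (p1 X p j) q (bracket (ddu χ i) (X i) q) = 0 := fun j => by
    rw [h.dform_p1_bracket_ddu_X hq, hcoeff, ite_self]
  have hsection : IsLocalSection (derived (total Hs)) q (bracket (ddu χ i) (X i)) :=
    ⟨χ.source, χ.open_source, hq, h.smoothOn_bracket_ddu_X i,
      fun _ hq' => h.bracket_ddu_X_mem_derived hq' i⟩
  have hcauchy : bracket (ddu χ i) (X i) q ∈ cauchy (derived (total Hs)) q := by
    refine Submodule.subset_span ⟨bracket (ddu χ i) (X i), hsection, rfl, fun Z hZ => ?_⟩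
    obtain ⟨V, hVU, hV, hqV, hYV, hZV⟩ := hsection.exists_isSectionOn_pair hZ χ.open_source hq
    rw [h.mem_derived_iff hq, dform_bracket_of_dform_eq_sum (a := p1 X p) (x := xfun χ) hV
      hYV.1 hZV.1 (h.invariants.1.mono hVU) (fun j => (h.contMDiffOn_p1 j).mono hVU)
      (fun j => (contMDiffOn_xfun χ j).mono hVU)
      (fun q' hq' => (h.mem_derived_iff (hVU hq') _).1 (hYV.2 q' hq'))
      (fun q' hq' => (h.mem_derived_iff (hVU hq') _).1 (hZV.2 q' hq')) hqV]
    simp [hp₁, h.dform_xfun_bracket_ddu_X hq]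
  rw [h.adapted.cauchy_eq q hq] at hcauchy
  have hnot := (h.linearIndependent_calA hq).notMem_span_image
    (s := range Sum.inl) (x := Sum.inr i) (by simp)
  rw [← range_comp] at hnot
  exact hnot hcauchy

theorem isJetSystem (h : HasInvariants Hs χ X p) :
    IsJetSystem (total Hs) χ.source (xfun χ) p (p1 X p) (pSym X p) where
  toIsJetSubsystem := h.isJetSubsystem
  mem_of_contact q hq v hv hv₁ := by
    obtain ⟨b, c, hbc⟩ := (mem_calA_iff_exists χ X).1 (h.sub_sum_smul_X_mem_calA hq hv)
    have hp₁ : ∀ i, dform (p1 X p i) q (v - ∑ k, dform (xfun χ k) q v • X k q) = 0 := fun i => by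
      rw [map_sub, map_sum, hv₁]
      simp [dform_p1_X, h.pSym_eq hq, mul_comm]
    have hc : ∀ i, c i = 0 := fun i => by
      have hp₁i := hp₁ i
      rw [hbc, map_add, map_sum, map_sum] at hp₁i
      simpa [h.dform_p1_ddu hq, h.dform_p1_bracket_ddu_X hq, h.verticalCoeff_ne_zero hq]
        using hp₁i
    rw [← sub_add_cancel v (∑ k, dform (xfun χ k) q v • X k q), hbc]
    simp only [hc, zero_smul, Finset.sum_const_zero, add_zero]
    exact Submodule.add_mem _ (Submodule.sum_mem _ fun k _ =>
      Submodule.smul_mem _ _ (h.ddu_mem hq k)) (Submodule.sum_mem _ fun k _ =>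
      Submodule.smul_mem _ _ (h.X_mem hq k))

theorem isJetFrameAt (h : HasInvariants Hs χ X p) (hq : q ∈ χ.source) :
    IsJetFrameAt (total Hs) (xfun χ) p (p1 X p) (pSym X p) q X (ddu χ)
      (fun i => bracket (ddu χ i) (X i) q) (fun i => verticalCoeff χ X p i q) where
  section_T := h.isLocalSection_X hq
  section_V := h.isLocalSection_ddu hq
  dx_T := h.dform_xfun_X hq
  dx_V := dform_xfun_ddu χ hq
  mem_span_V _ hv hx := h.mem_span_ddu hq hv hx
  du₂_T i j k := by
    rw [h.dform_pSym hq, h.dform_pSym hq]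
    exact h.dform_p2_X_comm hq i j k
  du₂_V := h.dform_pSym_ddu hq
  a_ne := h.verticalCoeff_ne_zero hq
  dx_B := h.dform_xfun_bracket_ddu_X hq
  du_B := h.dform_p_bracket_ddu_X hq
  du₁_B := h.dform_p1_bracket_ddu_X hq

theorem eq_zero_of_dform_eq_zero (h : HasInvariants Hs χ X p) (hq : q ∈ χ.source)
    {v : TangentSpace 𝓘(ℝ, E) q} (hx : ∀ i, dform (xfun χ i) q v = 0) (hp : dform p q v = 0)
    (hp₁ : ∀ i, dform (p1 X p i) q v = 0) (hp₂ : ∀ i, dform (pSym X p s(i, i)) q v = 0) :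
    v = 0 := by
  have hv : v ∈ total Hs q := by
    refine (h.isJetSystem.mem_iff hq v).2 ⟨?_, fun i => ?_⟩
    · simp [hx, hp]
    · simp [hx, hp₁]
  rw [(h.isJetFrameAt hq).eq_sum hv]
  simp [hx, hp₂, verticalForm_apply]

end HasInvariants

end Invariants

section SmoothForms

variable {E : Type*} [NormedAddCommGroup E] [NormedSpace ℝ E]
  {M : Type*} [TopologicalSpace M] [ChartedSpace E M] [IsManifold 𝓘(ℝ, E) ∞ M] {U : Set M}

theorem smoothFormOn_dform {f : M → ℝ} (hf : ContMDiffOn 𝓘(ℝ, E) 𝓘(ℝ, ℝ) ∞ f U) :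
    SmoothFormOn (dform (E := E) f) U :=
  fun _ hV hVU _ hY => hY.contMDiffOn_der hV (hf.mono hVU)

theorem SmoothFormOn.sub {α β : OneForm E M} (hα : SmoothFormOn α U) (hβ : SmoothFormOn β U) :
    SmoothFormOn (fun q => α q - β q) U :=
  fun V hV hVU Y hY => (hα V hV hVU Y hY).sub (hβ V hV hVU Y hY)

theorem SmoothFormOn.smul {f : M → ℝ} {α : OneForm E M}
    (hf : ContMDiffOn 𝓘(ℝ, E) 𝓘(ℝ, ℝ) ∞ f U) (hα : SmoothFormOn α U) :
    SmoothFormOn (fun q => f q • α q) U :=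
  fun V hV hVU Y hY => (hf.mono hVU).mul (hα V hV hVU Y hY)

theorem SmoothFormOn.sum {ι : Type*} [Fintype ι] {α : ι → OneForm E M}
    (hα : ∀ i, SmoothFormOn (α i) U) : SmoothFormOn (fun q => ∑ i, α i q) U := fun V hV hVU Y hY =>
  (contMDiffOn_finsetSum fun i _ => hα i V hV hVU Y hY).congr fun _ _ => LinearMap.sum_apply ..

theorem extD_eq_neg_apply_bracket {D : Distribution E M} {θ : OneForm E M} (hU : IsOpen U)
    (hθ : ∀ q ∈ U, ∀ v ∈ D q, θ q v = 0) {q : M} (hq : q ∈ U) {Y Z : VField E M}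
    (hY : IsLocalSection D q Y) (hZ : IsLocalSection D q Z) :
    extD θ Y Z q = -θ q (bracket Y Z q) := by
  have der_apply : ∀ Y Z : VField E M, IsLocalSection D q Y →
      der Z (fun q' => θ q' (Y q')) q = 0 := by
    rintro Y Z ⟨V, hV, hqV, -, hYD⟩
    have hθY : (fun q' => θ q' (Y q')) =ᶠ[𝓝 q] fun _ => 0 := by
      filter_upwards [(hU.inter hV).mem_nhds ⟨hq, hqV⟩] with q' hq'
      exact hθ q' hq'.1 _ (hYD q' hq'.2)
    rw [der, dform_congr hθY, dform_const]
    rfl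
  rw [extD, der_apply Y Z hY, der_apply Z Y hZ, sub_zero, zero_sub]

end SmoothForms

section InverseFunction

theorem isLocalDiffeomorphAt_of_eqOn {𝕜 : Type*} [NontriviallyNormedField 𝕜]
    {E F : Type*} [NormedAddCommGroup E] [NormedSpace 𝕜 E] [NormedAddCommGroup F] [NormedSpace 𝕜 F]
    {H G : Type*} [TopologicalSpace H] [TopologicalSpace G]
    {I : ModelWithCorners 𝕜 E H} {J : ModelWithCorners 𝕜 F G}
    {M N : Type*} [TopologicalSpace M] [ChartedSpace H M] [TopologicalSpace N] [ChartedSpace G N]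
    {m : ℕ∞ω} {f g : M → N} {q : M} (hf : IsLocalDiffeomorphAt I J m f q) {S : Set M}
    (hS : IsOpen S) (hq : q ∈ S) (hgf : EqOn g f S) : IsLocalDiffeomorphAt I J m g q := by
  obtain ⟨Ψ, hqΨ, hfΨ⟩ := hf
  let e := Ψ.toOpenPartialHomeomorph.restrOpen S hS
  exact ⟨{ toPartialEquiv := e.toPartialEquiv
           open_source := e.open_source
           open_target := e.open_target
           contMDiffOn_toFun := Ψ.contMDiffOn_toFun.mono fun _ hz => hz.1
           contMDiffOn_invFun := Ψ.contMDiffOn_invFun.mono fun _ hz => hz.1 }, ⟨hqΨ, hq⟩,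
    fun _ hz => (hgf hz.2).trans (hfΨ hz.1)⟩

theorem isLocalDiffeomorphAt_of_injective {𝕜 : Type*} [RCLike 𝕜]
    {F G : Type*} [NormedAddCommGroup F] [NormedSpace 𝕜 F] [FiniteDimensional 𝕜 F]
    [NormedAddCommGroup G] [NormedSpace 𝕜 G] [FiniteDimensional 𝕜 G]
    (hdim : Module.finrank 𝕜 F = Module.finrank 𝕜 G) {m : ℕ∞ω} (hm : m ≠ 0)
    {g : F → G} {S : Set F} (hS : IsOpen S) (hg : ContDiffOn 𝕜 m g S)
    (hinj : ∀ y ∈ S, Function.Injective (fderiv 𝕜 g y)) {y : F} (hy : y ∈ S) :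
    IsLocalDiffeomorphAt 𝓘(𝕜, F) 𝓘(𝕜, G) m g y := by
  have : CompleteSpace F := FiniteDimensional.complete 𝕜 F
  have hgAt : ∀ z ∈ S, ContDiffAt 𝕜 m g z := fun z hz => hg.contDiffAt (hS.mem_nhds hz)
  have hequiv : ∀ z ∈ S, ∃ L : F ≃L[𝕜] G, HasFDerivAt g (L : F →L[𝕜] G) z := fun z hz =>
    ⟨(LinearEquiv.ofInjectiveOfFinrankEq (fderiv 𝕜 g z : F →ₗ[𝕜] G)
      (hinj z hz) hdim).toContinuousLinearEquiv, ((hgAt z hz).differentiableAt hm).hasFDerivAt⟩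
  obtain ⟨L, hL⟩ := hequiv y hy
  let e := ((hgAt y hy).toOpenPartialHomeomorph g hL hm).restrOpen S hS
  have hsource : e.source ⊆ S := fun _ hz => hz.2
  refine ⟨{ toPartialEquiv := e.toPartialEquiv
            open_source := e.open_source
            open_target := e.open_target
            contMDiffOn_toFun := (hg.mono hsource).contMDiffOn
            contMDiffOn_invFun := ContDiffOn.contMDiffOn fun w hw => ?_ },
    ⟨(hgAt y hy).mem_toOpenPartialHomeomorph_source hL hm, hy⟩, fun _ _ => rfl⟩
  have hz : e.symm w ∈ S := hsource (e.map_target hw)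
  obtain ⟨L', hL'⟩ := hequiv _ hz
  exact (e.contDiffAt_symm hw hL' (hgAt _ hz)).contDiffWithinAt

end InverseFunction

section JetMaps

variable {E : Type*} [NormedAddCommGroup E] [NormedSpace ℝ E]
  {M : Type*} [TopologicalSpace M] [ChartedSpace E M]
  {n : ℕ} {ι : Type*} [Fintype ι]

theorem mfderiv_jet_apply {f : M → (Fin n → ℝ) × ℝ × (Fin n → ℝ) × (ι → ℝ)} {q : M}
    (hf : MDifferentiableAt 𝓘(ℝ, E) 𝓘(ℝ, (Fin n → ℝ) × ℝ × (Fin n → ℝ) × (ι → ℝ)) f q)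
    (v : TangentSpace 𝓘(ℝ, E) q) :
    mfderiv 𝓘(ℝ, E) 𝓘(ℝ, (Fin n → ℝ) × ℝ × (Fin n → ℝ) × (ι → ℝ)) f q v =
      ((fun i => dform (fun q' => (f q').1 i) q v, dform (fun q' => (f q').2.1) q v,
        fun i => dform (fun q' => (f q').2.2.1 i) q v,
        fun s => dform (fun q' => (f q').2.2.2 s) q v) :
          (Fin n → ℝ) × ℝ × (Fin n → ℝ) × (ι → ℝ)) := by
  have hcomponent := fun L => (dform_clm_comp hf L v).symm
  let prₓ := ContinuousLinearMap.fst ℝ (Fin n → ℝ) (ℝ × (Fin n → ℝ) × (ι → ℝ))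
  let pr₀ := ContinuousLinearMap.snd ℝ (Fin n → ℝ) (ℝ × (Fin n → ℝ) × (ι → ℝ))
  let pr₁ := (ContinuousLinearMap.snd ℝ ℝ ((Fin n → ℝ) × (ι → ℝ))).comp pr₀
  refine Prod.ext (funext fun i => ?_) (Prod.ext ?_ (Prod.ext (funext fun i => ?_)
    (funext fun s => ?_)))
  · exact hcomponent ((ContinuousLinearMap.proj i).comp prₓ)
  · exact hcomponent ((ContinuousLinearMap.fst ℝ _ _).comp pr₀)
  · exact hcomponent ((ContinuousLinearMap.proj i).comp ((ContinuousLinearMap.fst ℝ _ _).comp pr₁))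
  · exact hcomponent ((ContinuousLinearMap.proj s).comp ((ContinuousLinearMap.snd ℝ _ _).comp pr₁))

end JetMaps

section Invariants

variable {E : Type*} [NormedAddCommGroup E] [NormedSpace ℝ E]
  {M : Type*} [TopologicalSpace M] [ChartedSpace E M] {n : ℕ}

theorem p2_self_eq (X : Fin n → VField E M) (p : M → ℝ) (i : Fin n) :
    p2 X p i i = pSym X p s(i, i) := by
  simp [pSym]

variable [IsManifold 𝓘(ℝ, E) ∞ M]

namespace HasInvariants

variable {Hs : Fin n → Distribution E M} {χ : CoordSystem n E M} {X : Fin n → VField E M}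
  {p : M → ℝ} {q : M}

theorem contMDiffOn_phi (h : HasInvariants Hs χ X p) :
    ContMDiffOn 𝓘(ℝ, E) 𝓘(ℝ, JDiag n) ∞ (phi χ X p) χ.source :=
  (contMDiffOn_pi_space.2 (contMDiffOn_xfun χ)).prodMk_space
    (h.invariants.1.prodMk_space ((contMDiffOn_pi_space.2 h.contMDiffOn_p1).prodMk_space
      (contMDiffOn_pi_space.2 fun i => h.contMDiffOn_p2 i i)))

theorem contMDiffOn_Phi (h : HasInvariants Hs χ X p) :
    ContMDiffOn 𝓘(ℝ, E) 𝓘(ℝ, J2 n) ∞ (Phi χ X p) χ.source :=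
  (contMDiffOn_pi_space.2 (contMDiffOn_xfun χ)).prodMk_space
    (h.invariants.1.prodMk_space ((contMDiffOn_pi_space.2 h.contMDiffOn_p1).prodMk_space
      (contMDiffOn_pi_space.2 fun _ => h.contMDiffOn_p2 _ _)))

theorem mdifferentiableAt_phi (h : HasInvariants Hs χ X p) (hq : q ∈ χ.source) :
    MDifferentiableAt 𝓘(ℝ, E) 𝓘(ℝ, JDiag n) (phi χ X p) q :=
  (h.contMDiffOn_phi.contMDiffAt (χ.open_source.mem_nhds hq)).mdifferentiableAt (by simp)

theorem mfderiv_phi (h : HasInvariants Hs χ X p) (hq : q ∈ χ.source)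
    (v : TangentSpace 𝓘(ℝ, E) q) :
    mfderiv 𝓘(ℝ, E) 𝓘(ℝ, JDiag n) (phi χ X p) q v =
      ((fun i => dform (xfun χ i) q v, dform p q v, fun i => dform (p1 X p i) q v,
        fun i => dform (pSym X p s(i, i)) q v) : JDiag n) := by
  simp only [← p2_self_eq]
  exact mfderiv_jet_apply (h.mdifferentiableAt_phi hq) v

theorem dPhi_apply (h : HasInvariants Hs χ X p) (hq : q ∈ χ.source)
    (v : TangentSpace 𝓘(ℝ, E) q) :
    dPhi χ X p q v =
      ((fun i => dform (xfun χ i) q v, dform p q v, fun i => dform (p1 X p i) q v,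
        fun s => dform (pSym X p s) q v) : J2 n) :=
  mfderiv_jet_apply ((h.contMDiffOn_Phi.contMDiffAt
    (χ.open_source.mem_nhds hq)).mdifferentiableAt (by simp)) v

variable [CompleteSpace E]

theorem mfderiv_phi_injective (h : HasInvariants Hs χ X p) (hq : q ∈ χ.source) :
    Function.Injective (mfderiv 𝓘(ℝ, E) 𝓘(ℝ, JDiag n) (phi χ X p) q) := by
  refine (injective_iff_map_eq_zero _).2 fun v hv => ?_
  have hcomponents : (_ : JDiag n) = 0 := (h.mfderiv_phi hq v).symm.trans hv
  simp only [Prod.mk_eq_zero, funext_iff] at hcomponents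
  obtain ⟨hx, hp, hp₁, hp₂⟩ := hcomponents
  exact h.eq_zero_of_dform_eq_zero hq hx hp hp₁ hp₂

theorem dPhi_injective (h : HasInvariants Hs χ X p) (hq : q ∈ χ.source) :
    Function.Injective (dPhi χ X p q) := by
  refine (injective_iff_map_eq_zero _).2 fun v hv => ?_
  have hcomponents : (_ : J2 n) = 0 := (h.dPhi_apply hq v).symm.trans hv
  simp only [Prod.mk_eq_zero, funext_iff] at hcomponents
  obtain ⟨hx, hp, hp₁, hp₂⟩ := hcomponents
  exact h.eq_zero_of_dform_eq_zero hq hx hp hp₁ fun i => hp₂ s(i, i)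

theorem mfderiv_phi_surjective (h : HasInvariants Hs χ X p) (hq : q ∈ χ.source) :
    Function.Surjective (mfderiv 𝓘(ℝ, E) 𝓘(ℝ, JDiag n) (phi χ X p) q) := by
  have := h.finiteDimensional
  have hdim : Module.finrank ℝ E = Module.finrank ℝ (JDiag n) := by
    rw [h.dim_eq]
    simp [JDiag]
    ring
  let f : E →L[ℝ] JDiag n := mfderiv 𝓘(ℝ, E) 𝓘(ℝ, JDiag n) (phi χ X p) q
  exact (LinearMap.injective_iff_surjective_of_finrank_eq_finrank (f := (f : E →ₗ[ℝ] JDiag n))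
    hdim).1 (h.mfderiv_phi_injective hq)

theorem isLocalDiffeomorphOn_phi (h : HasInvariants Hs χ X p) :
    IsLocalDiffeomorphOn 𝓘(ℝ, E) 𝓘(ℝ, JDiag n) ∞ (phi χ X p) χ.source := by
  rintro ⟨q, hq⟩
  have hsymm : ∀ y ∈ χ.target, χ.symm y ∈ χ.source := fun y hy => χ.map_target hy
  have hsmooth : ContMDiffOn 𝓘(ℝ, Coord n) 𝓘(ℝ, JDiag n) ∞ (phi χ X p ∘ χ.symm) χ.target :=
    h.contMDiffOn_phi.comp χ.contMDiffOn_invFun hsymm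
  have hinj : ∀ y ∈ χ.target, Function.Injective (fderiv ℝ (phi χ X p ∘ χ.symm) y) := by
    intro y hy
    have hcomp := mfderiv_comp y (h.mdifferentiableAt_phi (hsymm y hy))
      (χ.symm.mdifferentiableAt (by simp) (x := y) hy)
    rw [mfderiv_eq_fderiv] at hcomp
    rw [hcomp]
    exact (h.mfderiv_phi_injective (hsymm y hy)).comp
      ((χ.symm.isLocalDiffeomorphAt _ _ _ hy).mfderivToContinuousLinearEquiv
        (by simp)).injective
  have hdim : Module.finrank ℝ (Coord n) = Module.finrank ℝ (JDiag n) := by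
    simp [Coord, JDiag]
    ring
  have hchart := isLocalDiffeomorphAt_of_injective hdim (by simp) χ.open_target
    hsmooth.contDiffOn hinj (χ.map_source hq)
  exact isLocalDiffeomorphAt_of_eqOn (IsLocalDiffeomorphAt.comp
    (hf := χ.isLocalDiffeomorphAt _ _ _ hq) (hg := hchart)) χ.open_source hq fun q' hq' =>
      congrArg (phi χ X p) (χ.left_inv hq').symm

theorem total_eq_comap (h : HasInvariants Hs χ X p) (hq : q ∈ χ.source) :
    total Hs q = (contact n (Phi χ X p q)).comap (dPhi χ X p q) := by
  ext v
  rw [h.isJetSystem.mem_iff hq, Submodule.mem_comap, h.dPhi_apply hq]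
  exact Iff.rfl

end HasInvariants

end Invariants

section StructureEquations

variable {E : Type*} [NormedAddCommGroup E] [NormedSpace ℝ E]
  {M : Type*} [TopologicalSpace M] [ChartedSpace E M] {n : ℕ}

/-- The coframe form `π^i = (dp_{ii} - ∑ (X_j p_{ii}) dx_j) / a_i`, dual to `∂/∂u_i`. -/
noncomputable def piForm (χ : CoordSystem n E M) (X : Fin n → VField E M) (p : M → ℝ)
    (i : Fin n) : OneForm E M := fun q =>
  verticalForm (xfun χ) (pSym X p) q X (fun k => verticalCoeff χ X p k q) i

/-- The contact form `dp - ∑ p_i dx_i`. -/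
noncomputable def thetaZero (χ : CoordSystem n E M) (X : Fin n → VField E M) (p : M → ℝ) :
    OneForm E M := fun q => dform p q - ∑ i, p1 X p i q • dform (xfun χ i) q

/-- The contact form `dp_i - ∑ p_{ij} dx_j`, multiplied by `-1 / a_i` so that
`dθ^i ≡ π^i ∧ dx_i`. -/
noncomputable def thetaForm (χ : CoordSystem n E M) (X : Fin n → VField E M) (p : M → ℝ)
    (i : Fin n) : OneForm E M := fun q =>
  (-(verticalCoeff χ X p i q)⁻¹) •
    (dform (p1 X p i) q - ∑ j, pSym X p s(i, j) q • dform (xfun χ j) q)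

theorem thetaZero_apply (χ : CoordSystem n E M) (X : Fin n → VField E M) (p : M → ℝ) (q : M)
    (v : TangentSpace 𝓘(ℝ, E) q) :
    thetaZero χ X p q v = dform p q v - ∑ i, p1 X p i q * dform (xfun χ i) q v := by
  rw [thetaZero, LinearMap.sub_apply, LinearMap.sum_apply]
  rfl

theorem thetaForm_apply (χ : CoordSystem n E M) (X : Fin n → VField E M) (p : M → ℝ)
    (i : Fin n) (q : M) (v : TangentSpace 𝓘(ℝ, E) q) :
    thetaForm χ X p i q v = -(verticalCoeff χ X p i q)⁻¹ *
      (dform (p1 X p i) q v - ∑ j, pSym X p s(i, j) q * dform (xfun χ j) q v) := by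
  rw [thetaForm, LinearMap.smul_apply, LinearMap.sub_apply, LinearMap.sum_apply]
  rfl

variable [IsManifold 𝓘(ℝ, E) ∞ M]

namespace HasInvariants

variable {Hs : Fin n → Distribution E M} {χ : CoordSystem n E M} {X : Fin n → VField E M}
  {p : M → ℝ} {q : M}

theorem smoothFormOn_thetaZero (h : HasInvariants Hs χ X p) :
    SmoothFormOn (thetaZero χ X p) χ.source :=
  .sub (smoothFormOn_dform h.invariants.1)
    (.sum fun i => .smul (h.contMDiffOn_p1 i) (smoothFormOn_dform (contMDiffOn_xfun χ i)))

variable [CompleteSpace E]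

theorem contMDiffOn_inv_verticalCoeff (h : HasInvariants Hs χ X p) (i : Fin n) :
    ContMDiffOn 𝓘(ℝ, E) 𝓘(ℝ, ℝ) ∞ (fun q => (verticalCoeff χ X p i q)⁻¹) χ.source :=
  (h.contMDiffOn_verticalCoeff i).inv₀ fun _ hq => h.verticalCoeff_ne_zero hq i

theorem smoothFormOn_piForm (h : HasInvariants Hs χ X p) (i : Fin n) :
    SmoothFormOn (piForm χ X p i) χ.source :=
  .smul (h.contMDiffOn_inv_verticalCoeff i) (.sub (smoothFormOn_dform (h.contMDiffOn_p2 _ _))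
    (.sum fun j => .smul ((h.adapted.smooth j).contMDiffOn_der χ.open_source
      (h.contMDiffOn_p2 _ _)) (smoothFormOn_dform (contMDiffOn_xfun χ j))))

theorem smoothFormOn_thetaForm (h : HasInvariants Hs χ X p) (i : Fin n) :
    SmoothFormOn (thetaForm χ X p i) χ.source :=
  .smul (h.contMDiffOn_inv_verticalCoeff i).neg (.sub (smoothFormOn_dform (h.contMDiffOn_p1 i))
    (.sum fun j => .smul (h.contMDiffOn_p2 _ _) (smoothFormOn_dform (contMDiffOn_xfun χ j))))

theorem mem_total_iff_theta (h : HasInvariants Hs χ X p) (hq : q ∈ χ.source)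
    (v : TangentSpace 𝓘(ℝ, E) q) :
    v ∈ total Hs q ↔ thetaZero χ X p q v = 0 ∧ ∀ i, thetaForm χ X p i q v = 0 := by
  rw [h.isJetSystem.mem_iff hq]
  simp only [thetaZero_apply, thetaForm_apply, mul_eq_zero, neg_eq_zero, inv_eq_zero,
    h.verticalCoeff_ne_zero hq, false_or, sub_eq_zero]

theorem extDCongr_thetaZero (h : HasInvariants Hs χ X p) :
    ExtDCongr (total Hs) χ.source (thetaZero χ X p) (fun _ _ _ => 0) := by
  intro q hq Y Z hY hZ
  rw [extD_eq_neg_apply_bracket χ.open_source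
    (fun _ hq' v hv => ((h.mem_total_iff_theta hq' v).1 hv).1) hq hY hZ, thetaZero_apply,
    h.isJetSystem.dform_u_bracket hq hY hZ]
  simp

theorem extDCongr_thetaForm (h : HasInvariants Hs χ X p) (i : Fin n) :
    ExtDCongr (total Hs) χ.source (thetaForm χ X p i)
      (wedge (piForm χ X p i) (dform (xfun χ i))) := by
  intro q hq Y Z hY hZ
  rw [extD_eq_neg_apply_bracket χ.open_source
    (fun _ hq' v hv => ((h.mem_total_iff_theta hq' v).1 hv).2 i) hq hY hZ, thetaForm_apply,
    (h.isJetFrameAt hq).dform_u₁_bracket h.isJetSystem hq hY hZ i, add_sub_cancel_left, wedge,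
    neg_mul, neg_neg, inv_mul_cancel_left₀ (h.verticalCoeff_ne_zero hq i)]
  rfl

theorem piForm_X (h : HasInvariants Hs χ X p) (hq : q ∈ χ.source) (i j : Fin n) :
    piForm χ X p i q (X j q) = 0 := (h.isJetFrameAt hq).verticalForm_T i j

theorem piForm_ddu (h : HasInvariants Hs χ X p) (hq : q ∈ χ.source) (i j : Fin n) :
    piForm χ X p i q (ddu χ j q) = if i = j then 1 else 0 := (h.isJetFrameAt hq).verticalForm_V i j

theorem exists_dform_p_eq_one (h : HasInvariants Hs χ X p) (hq : q ∈ χ.source) :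
    ∃ v : TangentSpace 𝓘(ℝ, E) q, (∀ i, dform (xfun χ i) q v = 0) ∧ dform p q v = 1 := by
  obtain ⟨v, hv⟩ := h.mfderiv_phi_surjective hq ((0, 1, 0, 0) : JDiag n)
  have hv' := (h.mfderiv_phi hq v).symm.trans hv
  exact ⟨v, fun i => congrFun (congrArg Prod.fst hv') i, congrArg (fun z => z.2.1) hv'⟩

theorem linearIndependent_coframe (h : HasInvariants Hs χ X p) (hq : q ∈ χ.source) :
    LinearIndependent ℝ (Sum.elim (fun i : Fin n => dform (xfun χ i) q)
      (Sum.elim (fun i : Fin n => piForm χ X p i q)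
        (Sum.elim (fun _ : Unit => thetaZero χ X p q)
          (fun i : Fin n => thetaForm χ X p i q)))) := by
  refine Fintype.linearIndependent_iff.2 fun c hc => ?_
  have heval : ∀ v : TangentSpace 𝓘(ℝ, E) q,
      ∑ i, c (.inl i) * dform (xfun χ i) q v + (∑ i, c (.inr (.inl i)) * piForm χ X p i q v +
        (c (.inr (.inr (.inl ()))) * thetaZero χ X p q v +
          ∑ i, c (.inr (.inr (.inr i))) * thetaForm χ X p i q v)) = 0 := by
    intro v
    have := LinearMap.congr_fun hc v
    rw [LinearMap.sum_apply] at this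
    simpa [Fintype.sum_sum_type] using this
  have hθX := fun j => (h.mem_total_iff_theta hq _).1 (h.X_mem hq j)
  have hθddu := fun j => (h.mem_total_iff_theta hq _).1 (h.ddu_mem hq j)
  have hdx : ∀ j, c (.inl j) = 0 := fun j => by
    simpa [h.dform_xfun_X hq, h.piForm_X hq, (hθX j).1, (hθX j).2] using heval (X j q)
  have hπ : ∀ j, c (.inr (.inl j)) = 0 := fun j => by
    simpa [dform_xfun_ddu χ hq, h.piForm_ddu hq, (hθddu j).1, (hθddu j).2] using heval (ddu χ j q)
  have hθ : ∀ j, c (.inr (.inr (.inr j))) = 0 := fun j => by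
    have heval_bracket := heval (bracket (ddu χ j) (X j) q)
    simpa [hdx, hπ, thetaZero_apply, thetaForm_apply, h.dform_xfun_bracket_ddu_X hq,
      h.dform_p_bracket_ddu_X hq, h.dform_p1_bracket_ddu_X hq, h.verticalCoeff_ne_zero hq]
      using heval_bracket
  have hθ₀ : c (.inr (.inr (.inl ()))) = 0 := by
    obtain ⟨v, hv, hpv⟩ := h.exists_dform_p_eq_one hq
    simpa [hdx, hπ, hθ, thetaZero_apply, hv, hpv] using heval v
  rintro (i | i | _ | i)
  exacts [hdx i, hπ i, hθ₀, hθ i]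

end HasInvariants

end StructureEquations

section EquationManifold

variable {n : ℕ}

/-- `JDiag.toJ1` as a continuous linear map. -/
noncomputable def toJ1L (n : ℕ) : JDiag n →L[ℝ] J1 n :=
  (ContinuousLinearMap.fst ℝ _ _).prod
    (((ContinuousLinearMap.fst ℝ _ _).comp (ContinuousLinearMap.snd ℝ _ _)).prod
      ((ContinuousLinearMap.fst ℝ _ _).comp
        ((ContinuousLinearMap.snd ℝ _ _).comp (ContinuousLinearMap.snd ℝ _ _))))

theorem toJ1L_apply (z : JDiag n) : toJ1L n z = z.toJ1 := rfl

/-- The second derivative `u_s`, `s = {i, j}`, as a function of the coordinates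
`(x_i, u, u_i, u_{ii})` of the equation manifold. -/
def uSym (F : Fin n → Fin n → J1 n → ℝ) (s : Sym2 (Fin n)) (z : JDiag n) : ℝ :=
  (equationParam F z).2.2.2 s

theorem uSym_self (F : Fin n → Fin n → J1 n → ℝ) (i : Fin n) (z : JDiag n) :
    uSym F s(i, i) z = z.2.2.2 i := by
  simp [uSym, equationParam]

theorem sym2_inf_lt_sup {i j : Fin n} (hij : i ≠ j) : (s(i, j)).inf < (s(i, j)).sup :=
  inf_lt_sup.2 hij

theorem uSym_of_ne (F : Fin n → Fin n → J1 n → ℝ) {i j : Fin n} (hij : i ≠ j) :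
    uSym F s(i, j) = fun z => F (s(i, j)).inf (s(i, j)).sup (toJ1L n z) :=
  funext fun _ => if_neg (sym2_inf_lt_sup hij).ne

theorem dform_eq_fderiv {E : Type*} [NormedAddCommGroup E] [NormedSpace ℝ E] (f : E → ℝ)
    (z v : E) : dform (E := E) f z v = fderiv ℝ f z v :=
  congrArg (fun L : E →L[ℝ] ℝ => L v) mfderiv_eq_fderiv

theorem dform_clm {E : Type*} [NormedAddCommGroup E] [NormedSpace ℝ E] (L : E →L[ℝ] ℝ)
    (z v : E) : dform (E := E) (fun z => L z) z v = L v := by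
  rw [dform_eq_fderiv, L.fderiv]

theorem dform_coord_x (i : Fin n) (z v : JDiag n) :
    dform (E := JDiag n) (fun z : JDiag n => z.1 i) z v = v.1 i :=
  dform_clm (E := JDiag n) ((ContinuousLinearMap.proj i).comp (ContinuousLinearMap.fst ℝ _ _)) z v

theorem dform_coord_u (z v : JDiag n) :
    dform (E := JDiag n) (fun z : JDiag n => z.2.1) z v = v.2.1 :=
  dform_clm (E := JDiag n)
    ((ContinuousLinearMap.fst ℝ _ _).comp (ContinuousLinearMap.snd ℝ _ _)) z v

theorem dform_coord_u₁ (i : Fin n) (z v : JDiag n) :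
    dform (E := JDiag n) (fun z : JDiag n => z.2.2.1 i) z v = v.2.2.1 i :=
  dform_clm (E := JDiag n) ((ContinuousLinearMap.proj i).comp ((ContinuousLinearMap.fst ℝ _ _).comp
    ((ContinuousLinearMap.snd ℝ _ _).comp (ContinuousLinearMap.snd ℝ _ _)))) z v

variable {W : Set (J1 n)} {F : Fin n → Fin n → J1 n → ℝ} {z : JDiag n}

theorem dform_uSym_self (i : Fin n) (z v : JDiag n) :
    dform (E := JDiag n) (uSym F s(i, i)) z v = v.2.2.2 i := by
  rw [show uSym F s(i, i) = fun z => z.2.2.2 i from funext (uSym_self F i)]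
  exact dform_clm (E := JDiag n) ((ContinuousLinearMap.proj i).comp
    ((ContinuousLinearMap.snd ℝ _ _).comp ((ContinuousLinearMap.snd ℝ _ _).comp
      (ContinuousLinearMap.snd ℝ _ _)))) z v

theorem dform_uSym_of_ne (hW : IsOpen W) (hF : ∀ i j, i < j → ContDiffOn ℝ ∞ (F i j) W)
    {i j : Fin n} (hij : i ≠ j) (hz : z.toJ1 ∈ W) (v : JDiag n) :
    dform (E := JDiag n) (uSym F s(i, j)) z v =
      fderiv ℝ (F (s(i, j)).inf (s(i, j)).sup) z.toJ1 v.toJ1 := by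
  have hFz : DifferentiableAt ℝ (F (s(i, j)).inf (s(i, j)).sup) (toJ1L n z) :=
    ((hF _ _ (sym2_inf_lt_sup hij)).contDiffAt (hW.mem_nhds hz)).differentiableAt (by simp)
  rw [uSym_of_ne F hij, dform_eq_fderiv]
  exact congrArg (fun L : JDiag n →L[ℝ] ℝ => L v)
    (hFz.hasFDerivAt.comp z (toJ1L n).hasFDerivAt).fderiv

theorem isOpen_over (hW : IsOpen W) : IsOpen {z : JDiag n | z.toJ1 ∈ W} :=
  hW.preimage (toJ1L n).continuous

theorem contDiffOn_uSym (hF : ∀ i j, i < j → ContDiffOn ℝ ∞ (F i j) W) (s : Sym2 (Fin n)) :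
    ContDiffOn ℝ ∞ (uSym F s) {z : JDiag n | z.toJ1 ∈ W} := by
  induction s using Sym2.ind with
  | _ i j =>
    by_cases hij : i = j
    · subst hij
      rw [show uSym F s(i, i) = fun z => z.2.2.2 i from funext (uSym_self F i)]
      fun_prop
    · rw [uSym_of_ne F hij]
      exact (hF _ _ (sym2_inf_lt_sup hij)).comp (toJ1L n).contDiff.contDiffOn fun z hz => hz

theorem contDiffOn_equationParam (hF : ∀ i j, i < j → ContDiffOn ℝ ∞ (F i j) W) :
    ContDiffOn ℝ ∞ (equationParam F) {z : JDiag n | z.toJ1 ∈ W} :=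
  contDiff_fst.contDiffOn.prodMk ((contDiff_fst.comp contDiff_snd).contDiffOn.prodMk
    ((contDiff_fst.comp (contDiff_snd.comp contDiff_snd)).contDiffOn.prodMk
      (contDiffOn_pi.2 (contDiffOn_uSym hF))))

theorem mem_equationDistribution_iff (hW : IsOpen W)
    (hF : ∀ i j, i < j → ContDiffOn ℝ ∞ (F i j) W) (hz : z.toJ1 ∈ W)
    (v : TangentSpace 𝓘(ℝ, JDiag n) z) : v ∈ equationDistribution F z ↔
      dform (fun z : JDiag n => z.2.1) z v =
        ∑ i, z.2.2.1 i * dform (fun z : JDiag n => z.1 i) z v ∧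
      ∀ i, dform (fun z : JDiag n => z.2.2.1 i) z v =
        ∑ j, uSym F s(i, j) z * dform (fun z : JDiag n => z.1 j) z v := by
  have hdiff : MDifferentiableAt 𝓘(ℝ, JDiag n) 𝓘(ℝ, J2 n) (equationParam F) z :=
    (((contDiffOn_equationParam hF).contDiffAt ((isOpen_over hW).mem_nhds hz)).differentiableAt
      (by simp)).mdifferentiableAt
  have hmem : v ∈ equationDistribution F z ↔
      mfderiv 𝓘(ℝ, JDiag n) 𝓘(ℝ, J2 n) (equationParam F) z v ∈
        contact n (equationParam F z) := Iff.rfl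
  rw [hmem, mfderiv_jet_apply hdiff v]
  exact Iff.rfl

theorem isJetSystem_equation (hW : IsOpen W) (hF : ∀ i j, i < j → ContDiffOn ℝ ∞ (F i j) W) :
    IsJetSystem (equationDistribution F) {z : JDiag n | z.toJ1 ∈ W}
      (fun i z => z.1 i) (fun z => z.2.1) (fun i z => z.2.2.1 i) (uSym F) where
  isOpen := isOpen_over hW
  smooth_x i := ContDiffOn.contMDiffOn (by fun_prop)
  smooth_u := ContDiffOn.contMDiffOn (by fun_prop)
  smooth_u₁ i := ContDiffOn.contMDiffOn (by fun_prop)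
  smooth_u₂ s := (contDiffOn_uSym hF s).contMDiffOn
  contact_of_mem z hz v := (mem_equationDistribution_iff hW hF hz v).1
  mem_of_contact z hz v h₀ h₁ := (mem_equationDistribution_iff hW hF hz v).2 ⟨h₀, h₁⟩

theorem mem_equationDistribution_iff_coord (hW : IsOpen W)
    (hF : ∀ i j, i < j → ContDiffOn ℝ ∞ (F i j) W) (hz : z.toJ1 ∈ W) (v : JDiag n) :
    v ∈ equationDistribution F z ↔
      v.2.1 = ∑ i, z.2.2.1 i * v.1 i ∧ ∀ i, v.2.2.1 i = ∑ j, uSym F s(i, j) z * v.1 j := by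
  refine (mem_equationDistribution_iff hW hF hz v).trans ?_
  simp only [dform_coord_x, dform_coord_u, dform_coord_u₁]

/-- The total derivative `D_k = ∂/∂x_k + u_k ∂/∂u + ∑ u_{lk} ∂/∂u_l` on `J¹`, which depends on the
second derivatives and hence on the point `z` of the equation manifold. -/
def totalD (F : Fin n → Fin n → J1 n → ℝ) (k : Fin n) (z : JDiag n) : J1 n :=
  (Pi.single k 1, z.2.2.1 k, fun l => uSym F s(l, k) z)

/-- The lift `D_k + ∑ c_l ∂/∂u_{ll}` of the total derivative to the equation manifold. -/
def liftD (F : Fin n → Fin n → J1 n → ℝ) (c : Fin n → ℝ) (k : Fin n) : VField (JDiag n) (JDiag n) :=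
  fun z => ((Pi.single k 1, z.2.2.1 k, fun l => uSym F s(l, k) z, c) : JDiag n)

/-- The coordinate vector field `∂/∂u_{kk}` of the equation manifold. -/
def verticalField (k : Fin n) : VField (JDiag n) (JDiag n) :=
  fun _ => ((0, 0, 0, Pi.single k 1) : JDiag n)

theorem isLocalSection_liftD (hW : IsOpen W) (hF : ∀ i j, i < j → ContDiffOn ℝ ∞ (F i j) W)
    (hz : z.toJ1 ∈ W) (c : Fin n → ℝ) (k : Fin n) :
    IsLocalSection (equationDistribution F) z (liftD F c k) := by
  refine ⟨_, isOpen_over hW, hz, fun y hy => ?_, fun y hy => ?_⟩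
  · have hu₂ : ContDiffOn ℝ ∞ (fun z l => uSym F s(l, k) z) {z : JDiag n | z.toJ1 ∈ W} :=
      contDiffOn_pi.2 fun l => contDiffOn_uSym hF s(l, k)
    have hu₁ : ContDiff ℝ ∞ (fun z : JDiag n => z.2.2.1 k) := by fun_prop
    exact contMDiffWithinAt_vectorSpace_iff_contDiffWithinAt.2 (ContDiffOn.prodMk contDiffOn_const
      (hu₁.contDiffOn.prodMk (hu₂.prodMk contDiffOn_const)) y hy)
  · refine (mem_equationDistribution_iff_coord hW hF hy _).2 ⟨?_, fun i => ?_⟩ <;>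
      simp [liftD, Pi.single_apply]

theorem isLocalSection_verticalField (hW : IsOpen W)
    (hF : ∀ i j, i < j → ContDiffOn ℝ ∞ (F i j) W) (hz : z.toJ1 ∈ W) (k : Fin n) :
    IsLocalSection (equationDistribution F) z (verticalField k) := by
  refine ⟨_, isOpen_over hW, hz, fun y _ => ?_, fun y hy => ?_⟩
  · exact contMDiffWithinAt_vectorSpace_iff_contDiffWithinAt.2 contDiffWithinAt_const
  · exact (mem_equationDistribution_iff_coord hW hF hy _).2 (by simp [verticalField])

theorem mem_span_verticalField (hW : IsOpen W) (hF : ∀ i j, i < j → ContDiffOn ℝ ∞ (F i j) W)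
    (hz : z.toJ1 ∈ W) {v : TangentSpace 𝓘(ℝ, JDiag n) z} (hv : v ∈ equationDistribution F z)
    (hx : ∀ i, dform (fun z : JDiag n => z.1 i) z v = 0) :
    v ∈ Submodule.span ℝ (range fun k => verticalField k z) := by
  change JDiag n at v
  replace hx : ∀ i, v.1 i = 0 := fun i => (dform_coord_x i z v).symm.trans (hx i)
  obtain ⟨hu, hu₁⟩ := (mem_equationDistribution_iff_coord hW hF hz v).1 hv
  simp only [hx, mul_zero, Finset.sum_const_zero] at hu hu₁
  refine (Submodule.mem_span_range_iff_exists_fun ℝ).2 ⟨v.2.2.2, ?_⟩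
  change (∑ k, v.2.2.2 k • ((0, 0, 0, Pi.single k 1) : JDiag n)) = v
  refine Prod.ext (funext fun i => ?_) (Prod.ext ?_
    (Prod.ext (funext fun i => ?_) (funext fun i => ?_)))
  · simp [Prod.fst_sum, hx]
  · simp [Prod.snd_sum, Prod.fst_sum, hu]
  · simp [Prod.snd_sum, Prod.fst_sum, hu₁]
  · simp [Prod.snd_sum, Finset.sum_apply, Pi.single_apply]

theorem dform_uSym_verticalField (hW : IsOpen W)
    (hF : ∀ i j, i < j → ContDiffOn ℝ ∞ (F i j) W) (hz : z.toJ1 ∈ W) (s : Sym2 (Fin n))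
    (k : Fin n) : dform (uSym F s) z (verticalField k z) = if s = s(k, k) then 1 else 0 := by
  induction s using Sym2.ind with
  | _ i j =>
    by_cases hij : i = j
    · subst hij
      refine (dform_uSym_self i z _).trans ?_
      simp [verticalField, Pi.single_apply]
    · refine (dform_uSym_of_ne hW hF hij hz _).trans ?_
      rw [show JDiag.toJ1 (verticalField k z : JDiag n) = 0 from rfl, map_zero, if_neg]
      simp only [Sym2.eq_iff, or_self, not_and]
      exact fun hi hj => hij (hi.trans hj.symm)

/-- The compatibility conditions `D_k F_{ij} = D_j F_{ik}`, for distinct `i, j, k`, at the point `z`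
of the equation manifold. -/
def IsCompatibleAt (F : Fin n → Fin n → J1 n → ℝ) (z : JDiag n) : Prop :=
  ∀ i j k, i ≠ j → i ≠ k → j ≠ k →
    fderiv ℝ (F (s(i, j)).inf (s(i, j)).sup) z.toJ1 (totalD F k z) =
      fderiv ℝ (F (s(i, k)).inf (s(i, k)).sup) z.toJ1 (totalD F j z)

/-- The component in the direction `∂/∂u_{ii}`, namely `D_i F_{ik}`, that the lift of `D_k` must
have for the lifts to be in involution at `z`; the component with `i = k` is irrelevant. -/
noncomputable def liftCoeff (F : Fin n → Fin n → J1 n → ℝ) (z : JDiag n) (k i : Fin n) : ℝ :=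
  fderiv ℝ (F (s(i, k)).inf (s(i, k)).sup) z.toJ1 (totalD F i z)

theorem IsCompatibleAt.dform_uSym_liftD_comm (hcomp : IsCompatibleAt F z) (hW : IsOpen W)
    (hF : ∀ i j, i < j → ContDiffOn ℝ ∞ (F i j) W) (hz : z.toJ1 ∈ W) (i j k : Fin n) :
    dform (uSym F s(i, j)) z (liftD F (liftCoeff F z k) k z) =
      dform (uSym F s(i, k)) z (liftD F (liftCoeff F z j) j z) := by
  have hself : ∀ i k, dform (uSym F s(i, i)) z (liftD F (liftCoeff F z k) k z) =
      liftCoeff F z k i := fun i k => dform_uSym_self i z _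
  have hne : ∀ i j k, i ≠ j → dform (uSym F s(i, j)) z (liftD F (liftCoeff F z k) k z) =
      fderiv ℝ (F (s(i, j)).inf (s(i, j)).sup) z.toJ1 (totalD F k z) :=
    fun i j k hij => dform_uSym_of_ne hW hF hij hz _
  by_cases hjk : j = k
  · rw [hjk]
  by_cases hij : i = j
  · subst hij
    rw [hself, hne i k i hjk, liftCoeff]
  by_cases hik : i = k
  · subst hik
    rw [hself, hne i j i hij, liftCoeff]
  · rw [hne i j k hij, hne i k j hik, hcomp i j k hij hik hjk]

theorem IsCompatibleAt.isJetFrameAt (hcomp : IsCompatibleAt F z) (hW : IsOpen W)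
    (hF : ∀ i j, i < j → ContDiffOn ℝ ∞ (F i j) W) (hz : z.toJ1 ∈ W) :
    IsJetFrameAt (equationDistribution F) (fun i z => z.1 i) (fun z => z.2.1)
      (fun i z => z.2.2.1 i) (uSym F) z (fun k => liftD F (liftCoeff F z k) k) verticalField
      (fun k => ((0, 0, Pi.single k 1, 0) : JDiag n)) (fun _ => 1) where
  section_T k := isLocalSection_liftD hW hF hz _ k
  section_V k := isLocalSection_verticalField hW hF hz k
  dx_T i j := by
    refine (dform_coord_x j z _).trans ?_
    simp [liftD, Pi.single_apply, eq_comm]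
  dx_V i j := dform_coord_x j z _
  mem_span_V _ := mem_span_verticalField hW hF hz
  du₂_T := hcomp.dform_uSym_liftD_comm hW hF hz
  du₂_V := dform_uSym_verticalField hW hF hz
  a_ne _ := one_ne_zero
  dx_B i j := dform_coord_x j z _
  du_B i := dform_coord_u z _
  du₁_B i j := by
    refine (dform_coord_u₁ j z _).trans ?_
    simp [Pi.single_apply, eq_comm]

theorem isGDMZ_of_isCompatibleAt (hW : IsOpen W)
    (hF : ∀ i j, i < j → ContDiffOn ℝ ∞ (F i j) W)
    (hcomp : ∀ z : JDiag n, z.toJ1 ∈ W → IsCompatibleAt F z) : IsGDMZ W F :=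
  ⟨hW, hF, fun z hz => ((hcomp z hz).isJetFrameAt hW hF hz).isInvolutiveAt
    (isJetSystem_equation hW hF) hz⟩

end EquationManifold

section LocalInverse

theorem exists_partialDiffeomorph_target_eq_ball {𝕜 : Type*} [NontriviallyNormedField 𝕜]
    {E : Type*} [NormedAddCommGroup E] [NormedSpace 𝕜 E] {H : Type*} [TopologicalSpace H]
    {I : ModelWithCorners 𝕜 E H} {M : Type*} [TopologicalSpace M] [ChartedSpace H M]
    {F : Type*} [NormedAddCommGroup F] [NormedSpace 𝕜 F] {m : WithTop ℕ∞} {f : M → F} {q : M}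
    (hf : IsLocalDiffeomorphAt I 𝓘(𝕜, F) m f q) {U : Set M} (hU : IsOpen U) (hq : q ∈ U) :
    ∃ (Ψ : PartialDiffeomorph I 𝓘(𝕜, F) M F m) (r : ℝ), 0 < r ∧ q ∈ Ψ.source ∧ Ψ.source ⊆ U ∧
      Ψ.target = Metric.ball (f q) r ∧ EqOn f Ψ Ψ.source := by
  obtain ⟨Ψ, hqΨ, heq⟩ := hf
  have hopen : IsOpen (Ψ.target ∩ Ψ.symm ⁻¹' U) :=
    Ψ.contMDiffOn_invFun.continuousOn.isOpen_inter_preimage Ψ.open_target hU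
  have hmem : f q ∈ Ψ.target ∩ Ψ.symm ⁻¹' U := by
    rw [heq hqΨ]
    have hleft : Ψ.symm (Ψ q) = q := Ψ.left_inv hqΨ
    exact ⟨Ψ.map_source hqΨ, show Ψ.symm (Ψ q) ∈ U from hleft.symm ▸ hq⟩
  obtain ⟨r, hr, hball⟩ := Metric.isOpen_iff.1 hopen _ hmem
  have hright : ∀ z ∈ Metric.ball (f q) r, Ψ (Ψ.symm z) = z :=
    fun z hz => Ψ.right_inv (hball hz).1
  let Ψ' : PartialDiffeomorph I 𝓘(𝕜, F) M F m :=
    { toFun := Ψ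
      invFun := Ψ.symm
      source := Ψ.source ∩ Ψ ⁻¹' Metric.ball (f q) r
      target := Metric.ball (f q) r
      map_source' := fun _ hy => hy.2
      map_target' := fun z hz => ⟨Ψ.map_target (hball hz).1,
        show Ψ (Ψ.symm z) ∈ Metric.ball (f q) r from (hright z hz).symm ▸ hz⟩
      left_inv' := fun _ hy => Ψ.left_inv hy.1
      right_inv' := hright
      open_source :=
        Ψ.contMDiffOn.continuousOn.isOpen_inter_preimage Ψ.open_source Metric.isOpen_ball
      open_target := Metric.isOpen_ball
      contMDiffOn_toFun := Ψ.contMDiffOn.mono inter_subset_left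
      contMDiffOn_invFun := Ψ.contMDiffOn_invFun.mono fun _ hz => (hball hz).1 }
  refine ⟨Ψ', r, hr, ⟨hqΨ, ?_⟩, fun y hy => ?_, rfl, heq.mono inter_subset_left⟩
  · rw [mem_preimage, ← heq hqΨ]
    exact Metric.mem_ball_self hr
  · have hleft : Ψ.symm (Ψ y) = y := Ψ.left_inv hy.1
    exact hleft ▸ (hball hy.2).2

theorem apply_add_eq_of_fderiv_comp_eq_zero {E F G : Type*} [NormedAddCommGroup E]
    [NormedSpace ℝ E] [NormedAddCommGroup F] [NormedSpace ℝ F] [NormedAddCommGroup G]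
    [NormedSpace ℝ G] {f : E → G} {z : E} {L : F →L[ℝ] E} {C : Set F} (hC : Convex ℝ C)
    (hC' : IsOpen C)
    (hf : ∀ t ∈ C, DifferentiableAt ℝ f (z + L t))
    (hL : ∀ t ∈ C, (fderiv ℝ f (z + L t)).comp L = 0) {t t' : F} (ht : t ∈ C) (ht' : t' ∈ C) :
    f (z + L t) = f (z + L t') := by
  have hderiv : ∀ t ∈ C, HasFDerivAt (fun t => f (z + L t)) (0 : F →L[ℝ] G) t := fun t ht =>
    hL t ht ▸ (hf t ht).hasFDerivAt.comp t (L.hasFDerivAt.const_add z)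
  exact hC'.is_const_of_fderiv_eq_zero hC.isPreconnected
    (fun t ht => (hderiv t ht).differentiableAt.differentiableWithinAt)
    (fun t ht => (hderiv t ht).fderiv) ht ht'

end LocalInverse

section PureSecondDerivatives

variable {n : ℕ}

/-- The point `(x_i, u, u_i, u_{ii})` of a 2-jet. -/
def diagPart (z : J2 n) : JDiag n := (z.1, z.2.1, z.2.2.1, fun i => z.2.2.2 s(i, i))

theorem diagPart_equationParam (F : Fin n → Fin n → J1 n → ℝ) (w : JDiag n) :
    diagPart (equationParam F w) = w :=
  Prod.ext rfl (Prod.ext rfl (Prod.ext rfl (funext fun i => uSym_self F i w)))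

theorem eq_equationParam_diagPart {W : Set (J1 n)} {F : Fin n → Fin n → J1 n → ℝ} {z : J2 n}
    (hz : z ∈ equationManifold W F) : z = equationParam F (diagPart z) := by
  rw [← equationParam_image] at hz
  obtain ⟨w, -, rfl⟩ := hz
  rw [diagPart_equationParam]

theorem continuous_diagPart : Continuous (diagPart (n := n)) := by
  unfold diagPart
  fun_prop

/-- The point with first-order part `w` and pure second derivatives `t`. -/
def joinDiag (w : J1 n) (t : Fin n → ℝ) : JDiag n := (w.1, w.2.1, w.2.2, t)

theorem mem_ball_joinDiag {z : JDiag n} {w₀ : J1 n} {t₀ : Fin n → ℝ} {r : ℝ} :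
    z ∈ Metric.ball (joinDiag w₀ t₀) r ↔
      z.toJ1 ∈ Metric.ball w₀ r ∧ z.2.2.2 ∈ Metric.ball t₀ r := by
  simp only [joinDiag, JDiag.toJ1, Metric.mem_ball, Prod.dist_eq, max_lt_iff, and_assoc]

theorem contDiff_joinDiag (t : Fin n → ℝ) : ContDiff ℝ ∞ fun w => joinDiag w t := by
  unfold joinDiag
  fun_prop

/-- The inclusion of the directions `∂/∂u_{ii}`. -/
noncomputable def inDiag (n : ℕ) : (Fin n → ℝ) →L[ℝ] JDiag n :=
  (ContinuousLinearMap.inr ℝ _ _).comp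
    ((ContinuousLinearMap.inr ℝ _ _).comp (ContinuousLinearMap.inr ℝ _ _))

theorem joinDiag_eq_add_inDiag (w : J1 n) (t : Fin n → ℝ) :
    joinDiag w t = joinDiag w 0 + inDiag n t := by
  simp [joinDiag, inDiag]

theorem totalD_joinDiag (F : Fin n → Fin n → J1 n → ℝ) (k : Fin n) (w : J1 n)
    (t t₀ : Fin n → ℝ) : totalD F k (joinDiag w t) =
      totalD F k (joinDiag w t₀) + (t k - t₀ k) • ((0, 0, Pi.single k 1) : J1 n) := by
  refine Prod.ext ?_ (Prod.ext ?_ (funext fun l => ?_))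
  · simp [totalD]
  · simp [totalD, joinDiag]
  · by_cases hl : l = k
    · subst hl
      simp [totalD, joinDiag, uSym_self]
    · simp [totalD, uSym_of_ne F hl, hl, toJ1L_apply, joinDiag, JDiag.toJ1]

/-- Both sides are affine in `t`, so they agree everywhere as soon as they agree on a ball. -/
theorem apply_totalD_joinDiag_eq {F : Fin n → Fin n → J1 n → ℝ} {j k : Fin n} (hjk : j ≠ k)
    {w : J1 n} {A A' : J1 n →L[ℝ] ℝ} {t₀ : Fin n → ℝ} {r : ℝ} (hr : 0 < r)
    (h : ∀ t ∈ Metric.ball t₀ r,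
      A (totalD F k (joinDiag w t)) = A' (totalD F j (joinDiag w t))) (t : Fin n → ℝ) :
    A (totalD F k (joinDiag w t)) = A' (totalD F j (joinDiag w t)) := by
  have hcentre := h t₀ (Metric.mem_ball_self hr)
  have hmem : ∀ l : Fin n, t₀ + Pi.single l (r / 2) ∈ Metric.ball t₀ r := fun l => by
    rw [mem_ball_iff_norm, add_sub_cancel_left, Pi.norm_single, Real.norm_eq_abs,
      abs_of_pos (half_pos hr)]
    exact half_lt_self hr
  have hshift_k := h _ (hmem k)
  have hshift_j := h _ (hmem j)
  rw [totalD_joinDiag F k w _ t₀, totalD_joinDiag F j w _ t₀, map_add, map_add, map_smul,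
    map_smul] at hshift_k hshift_j ⊢
  have hA : A (0, 0, Pi.single k 1) = 0 := by simpa [hcentre, hjk, hr.ne'] using hshift_k
  have hA' : A' (0, 0, Pi.single j 1) = 0 := by simpa [hcentre, hjk.symm, hr.ne'] using hshift_j
  rw [hcentre, hA, hA', smul_zero, smul_zero]

end PureSecondDerivatives

section LocalEquation

variable {n : ℕ} {E : Type*} [NormedAddCommGroup E] [NormedSpace ℝ E]
  {M : Type*} [TopologicalSpace M] [ChartedSpace E M]

theorem diagPart_Phi (χ : CoordSystem n E M) (X : Fin n → VField E M) (p : M → ℝ) (q : M) :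
    diagPart (Phi χ X p q) = phi χ X p q :=
  Prod.ext rfl (Prod.ext rfl (Prod.ext rfl
    (funext fun i => (congrFun (p2_self_eq X p i) q).symm)))

/-- `Ψ` is the restriction of `φ` to a diffeomorphism from an open subset of the coordinate domain
onto the ball of radius `r` around `(w₀, t₀)`, where `w₀` is the first-order part and `t₀` stands
for the pure second derivatives. -/
structure IsBallChart (χ : CoordSystem n E M) (X : Fin n → VField E M) (p : M → ℝ)
    (Ψ : PartialDiffeomorph 𝓘(ℝ, E) 𝓘(ℝ, JDiag n) M (JDiag n) ∞) (w₀ : J1 n) (t₀ : Fin n → ℝ)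
    (r : ℝ) : Prop where
  pos : 0 < r
  source_subset : Ψ.source ⊆ χ.source
  target_eq : Ψ.target = Metric.ball (joinDiag w₀ t₀) r
  eqOn : EqOn (phi χ X p) Ψ Ψ.source

/-- The functions `f_{ij}`, expressed in `(x, p, p_k)` by freezing the pure second derivatives at
`t₀`. -/
noncomputable def localRhs (X : Fin n → VField E M) (p : M → ℝ)
    (Ψ : PartialDiffeomorph 𝓘(ℝ, E) 𝓘(ℝ, JDiag n) M (JDiag n) ∞) (t₀ : Fin n → ℝ)
    (i j : Fin n) (w : J1 n) : ℝ :=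
  p2 X p i j (Ψ.symm (joinDiag w t₀))

variable {χ : CoordSystem n E M} {X : Fin n → VField E M} {p : M → ℝ} {q : M}
  {Ψ : PartialDiffeomorph 𝓘(ℝ, E) 𝓘(ℝ, JDiag n) M (JDiag n) ∞} {w₀ : J1 n} {t₀ : Fin n → ℝ} {r : ℝ}

namespace IsBallChart

theorem phi_mem_ball (hΨ : IsBallChart χ X p Ψ w₀ t₀ r) (hq : q ∈ Ψ.source) :
    phi χ X p q ∈ Metric.ball (joinDiag w₀ t₀) r := by
  rw [hΨ.eqOn hq, ← hΨ.target_eq]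
  exact Ψ.map_source hq

theorem toJ1_phi_mem_ball (hΨ : IsBallChart χ X p Ψ w₀ t₀ r) (hq : q ∈ Ψ.source) :
    (phi χ X p q).toJ1 ∈ Metric.ball w₀ r :=
  (mem_ball_joinDiag.1 (hΨ.phi_mem_ball hq)).1

theorem symm_phi (hΨ : IsBallChart χ X p Ψ w₀ t₀ r) (hq : q ∈ Ψ.source) :
    Ψ.symm (phi χ X p q) = q := by
  rw [hΨ.eqOn hq]
  exact Ψ.left_inv hq

theorem symm_mem (hΨ : IsBallChart χ X p Ψ w₀ t₀ r) {z : JDiag n}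
    (hz : z ∈ Metric.ball (joinDiag w₀ t₀) r) : Ψ.symm z ∈ Ψ.source :=
  Ψ.map_target (hΨ.target_eq ▸ hz)

theorem phi_symm (hΨ : IsBallChart χ X p Ψ w₀ t₀ r) {z : JDiag n}
    (hz : z ∈ Metric.ball (joinDiag w₀ t₀) r) : phi χ X p (Ψ.symm z) = z :=
  (hΨ.eqOn (hΨ.symm_mem hz)).trans (Ψ.right_inv (hΨ.target_eq ▸ hz))

theorem injOn_Phi (hΨ : IsBallChart χ X p Ψ w₀ t₀ r) :
    InjOn (Phi χ X p) Ψ.source := by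
  intro q hq q' hq' heq
  have hphi := congrArg diagPart heq
  rw [diagPart_Phi, diagPart_Phi] at hphi
  rw [← hΨ.symm_phi hq, hphi, hΨ.symm_phi hq']

end IsBallChart

variable [IsManifold 𝓘(ℝ, E) ∞ M] {Hs : Fin n → Distribution E M}

namespace HasInvariants

theorem dform_comp_phi (h : HasInvariants Hs χ X p) (hq : q ∈ χ.source) {g : JDiag n → ℝ}
    (hg : DifferentiableAt ℝ g (phi χ X p q)) (v : TangentSpace 𝓘(ℝ, E) q) :
    dform (fun q' => g (phi χ X p q')) q v =
      dform (E := JDiag n) g (phi χ X p q)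
        (mfderiv 𝓘(ℝ, E) 𝓘(ℝ, JDiag n) (phi χ X p) q v) :=
  congrArg (fun L : E →L[ℝ] ℝ => L v)
    (mfderiv_comp q hg.mdifferentiableAt (h.mdifferentiableAt_phi hq))

theorem contDiffOn_p2_symm (h : HasInvariants Hs χ X p) (hΨ : IsBallChart χ X p Ψ w₀ t₀ r)
    (i j : Fin n) :
    ContDiffOn ℝ ∞ (fun z => p2 X p i j (Ψ.symm z)) (Metric.ball (joinDiag w₀ t₀) r) :=
  ((h.contMDiffOn_p2 i j).comp (Ψ.contMDiffOn_invFun.mono hΨ.target_eq.ge)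
    fun _ hz => hΨ.source_subset (hΨ.symm_mem hz)).contDiffOn

theorem differentiableAt_p2_symm (h : HasInvariants Hs χ X p)
    (hΨ : IsBallChart χ X p Ψ w₀ t₀ r) (i j : Fin n) {z : JDiag n}
    (hz : z ∈ Metric.ball (joinDiag w₀ t₀) r) :
    DifferentiableAt ℝ (fun z => p2 X p i j (Ψ.symm z)) z :=
  ((h.contDiffOn_p2_symm hΨ i j).contDiffAt (Metric.isOpen_ball.mem_nhds hz)).differentiableAt
    (by simp)

theorem contDiffOn_localRhs (h : HasInvariants Hs χ X p) (hΨ : IsBallChart χ X p Ψ w₀ t₀ r)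
    (i j : Fin n) : ContDiffOn ℝ ∞ (localRhs X p Ψ t₀ i j) (Metric.ball w₀ r) :=
  (h.contDiffOn_p2_symm hΨ i j).comp (contDiff_joinDiag t₀).contDiffOn fun _ hw =>
    mem_ball_joinDiag.2 ⟨hw, Metric.mem_ball_self hΨ.pos⟩

variable [CompleteSpace E]

theorem exists_isBallChart (h : HasInvariants Hs χ X p) (hq : q ∈ χ.source) :
    ∃ Ψ w₀ t₀ r, IsBallChart χ X p Ψ w₀ t₀ r ∧ q ∈ Ψ.source := by
  obtain ⟨Ψ, r, hr, hqΨ, hsource, htarget, heq⟩ :=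
    exists_partialDiffeomorph_target_eq_ball (h.isLocalDiffeomorphOn_phi ⟨q, hq⟩) χ.open_source hq
  exact ⟨Ψ, (phi χ X p q).toJ1, (phi χ X p q).2.2.2, r, ⟨hr, hsource, htarget, heq⟩, hqΨ⟩

theorem exists_vertical_mfderiv_phi_eq (h : HasInvariants Hs χ X p) (hq : q ∈ χ.source)
    (s : Fin n → ℝ) : ∃ v ∈ Submodule.span ℝ (range fun k => ddu χ k q),
      mfderiv 𝓘(ℝ, E) 𝓘(ℝ, JDiag n) (phi χ X p) q v = inDiag n s := by
  obtain ⟨v, hv⟩ := h.mfderiv_phi_surjective hq (inDiag n s)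
  have hcoord := (h.mfderiv_phi hq v).symm.trans hv
  have hx : ∀ k, dform (xfun χ k) q v = 0 := fun k => congrFun (congrArg Prod.fst hcoord) k
  have hp : dform p q v = 0 := congrArg (fun z => z.2.1) hcoord
  have hp₁ : ∀ k, dform (p1 X p k) q v = 0 := fun k =>
    congrFun (congrArg (fun z => z.2.2.1) hcoord) k
  have hmem : v ∈ total Hs q := (h.isJetSystem.mem_iff hq v).2
    ⟨by simp [hx, hp], fun k => by simp [hx, hp₁]⟩
  exact ⟨v, h.mem_span_ddu hq hmem hx, hv⟩

theorem dform_p2_of_mem_span_ddu (h : HasInvariants Hs χ X p) (hq : q ∈ χ.source) {i j : Fin n}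
    (hij : i ≠ j) {v : TangentSpace 𝓘(ℝ, E) q}
    (hv : v ∈ Submodule.span ℝ (range fun k => ddu χ k q)) : dform (p2 X p i j) q v = 0 := by
  refine dform_eq_zero_of_mem_span_ddu (fun k => ?_) hv
  rw [← h.dform_pSym hq, h.dform_pSym_ddu hq, if_neg]
  simp only [Sym2.eq_iff, or_self, not_and]
  exact fun hi hj => hij (hi.trans hj.symm)

theorem fderiv_p2_symm_comp_inDiag (h : HasInvariants Hs χ X p)
    (hΨ : IsBallChart χ X p Ψ w₀ t₀ r) {i j : Fin n} (hij : i ≠ j) {z : JDiag n}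
    (hz : z ∈ Metric.ball (joinDiag w₀ t₀) r) :
    (fderiv ℝ (fun z => p2 X p i j (Ψ.symm z)) z).comp (inDiag n) = 0 := by
  have hmem := hΨ.symm_mem hz
  have hsource := hΨ.source_subset hmem
  ext1 s
  obtain ⟨v, hv, hvs⟩ := h.exists_vertical_mfderiv_phi_eq hsource s
  have hp2 : p2 X p i j =ᶠ[𝓝 (Ψ.symm z)] fun q' => p2 X p i j (Ψ.symm (phi χ X p q')) := by
    filter_upwards [Ψ.open_source.mem_nhds hmem] with q' hq'
    rw [hΨ.symm_phi hq']
  have hdiff := h.differentiableAt_p2_symm hΨ i j hz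
  rw [← hΨ.phi_symm hz] at hdiff
  have hzero := h.dform_p2_of_mem_span_ddu hsource hij hv
  rw [dform_congr hp2, h.dform_comp_phi hsource hdiff, hvs, dform_eq_fderiv, hΨ.phi_symm hz]
    at hzero
  exact hzero

theorem p2_symm_joinDiag (h : HasInvariants Hs χ X p) (hΨ : IsBallChart χ X p Ψ w₀ t₀ r)
    {i j : Fin n} (hij : i ≠ j) {w : J1 n} (hw : w ∈ Metric.ball w₀ r) {t : Fin n → ℝ}
    (ht : t ∈ Metric.ball t₀ r) :
    p2 X p i j (Ψ.symm (joinDiag w t)) = localRhs X p Ψ t₀ i j w := by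
  have hmem : ∀ t ∈ Metric.ball t₀ r,
      joinDiag w 0 + inDiag n t ∈ Metric.ball (joinDiag w₀ t₀) r := fun t ht =>
    joinDiag_eq_add_inDiag w t ▸ mem_ball_joinDiag.2 ⟨hw, ht⟩
  rw [localRhs, joinDiag_eq_add_inDiag w t, joinDiag_eq_add_inDiag w t₀]
  exact apply_add_eq_of_fderiv_comp_eq_zero (f := fun z => p2 X p i j (Ψ.symm z))
    (convex_ball t₀ r) Metric.isOpen_ball
    (fun t ht => h.differentiableAt_p2_symm hΨ i j (hmem t ht))
    (fun t ht => h.fderiv_p2_symm_comp_inDiag hΨ hij (hmem t ht)) ht (Metric.mem_ball_self hΨ.pos)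

theorem p2_eq_localRhs (h : HasInvariants Hs χ X p) (hΨ : IsBallChart χ X p Ψ w₀ t₀ r)
    (hq : q ∈ Ψ.source) {i j : Fin n} (hij : i ≠ j) :
    p2 X p i j q = localRhs X p Ψ t₀ i j (phi χ X p q).toJ1 := by
  obtain ⟨hw, ht⟩ := mem_ball_joinDiag.1 (hΨ.phi_mem_ball hq)
  exact (congrArg (p2 X p i j) (hΨ.symm_phi hq).symm).trans (h.p2_symm_joinDiag hΨ hij hw ht)

theorem pSym_eq_uSym (h : HasInvariants Hs χ X p) (hΨ : IsBallChart χ X p Ψ w₀ t₀ r)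
    (hq : q ∈ Ψ.source) (s : Sym2 (Fin n)) :
    pSym X p s q = uSym (localRhs X p Ψ t₀) s (phi χ X p q) := by
  induction s using Sym2.ind with
  | _ i j =>
    by_cases hij : i = j
    · subst hij
      rw [uSym_self, ← p2_self_eq]
      rfl
    · rw [uSym_of_ne _ hij]
      exact h.p2_eq_localRhs hΨ hq (sym2_inf_lt_sup hij).ne

theorem toJ1_mfderiv_phi_X (h : HasInvariants Hs χ X p) (hΨ : IsBallChart χ X p Ψ w₀ t₀ r)
    (hq : q ∈ Ψ.source) (k : Fin n) :
    JDiag.toJ1 (mfderiv 𝓘(ℝ, E) 𝓘(ℝ, JDiag n) (phi χ X p) q (X k q)) =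
      totalD (localRhs X p Ψ t₀) k (phi χ X p q) := by
  have hq' := hΨ.source_subset hq
  rw [h.mfderiv_phi hq']
  refine Prod.ext (funext fun l => ?_) (Prod.ext rfl (funext fun l => ?_))
  · refine (h.dform_xfun_X hq' k l).trans ?_
    simp [totalD, Pi.single_apply, eq_comm]
  · exact (h.pSym_eq hq' l k).symm.trans (h.pSym_eq_uSym hΨ hq s(l, k))

theorem fderiv_localRhs_totalD (h : HasInvariants Hs χ X p) (hΨ : IsBallChart χ X p Ψ w₀ t₀ r)
    (hq : q ∈ Ψ.source) {i j : Fin n} (hij : i ≠ j) (k : Fin n) :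
    fderiv ℝ (localRhs X p Ψ t₀ (s(i, j)).inf (s(i, j)).sup) (phi χ X p q).toJ1
        (totalD (localRhs X p Ψ t₀) k (phi χ X p q)) =
      dform (pSym X p s(i, j)) q (X k q) := by
  have hsmooth : ∀ i j, i < j → ContDiffOn ℝ ∞ (localRhs X p Ψ t₀ i j) (Metric.ball w₀ r) :=
    fun i j _ => h.contDiffOn_localRhs hΨ i j
  have hw := hΨ.toJ1_phi_mem_ball hq
  have hpSym : pSym X p s(i, j) =ᶠ[𝓝 q]
      fun q' => uSym (localRhs X p Ψ t₀) s(i, j) (phi χ X p q') := by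
    filter_upwards [Ψ.open_source.mem_nhds hq] with q' hq' using h.pSym_eq_uSym hΨ hq' _
  have hdiff : DifferentiableAt ℝ (uSym (localRhs X p Ψ t₀) s(i, j)) (phi χ X p q) :=
    ((contDiffOn_uSym hsmooth _).contDiffAt
      ((isOpen_over Metric.isOpen_ball).mem_nhds hw)).differentiableAt (by simp)
  rw [dform_congr hpSym, h.dform_comp_phi (hΨ.source_subset hq) hdiff,
    ← h.toJ1_mfderiv_phi_X hΨ hq]
  exact (dform_uSym_of_ne Metric.isOpen_ball hsmooth hij hw _).symm

theorem isGDMZ_localRhs (h : HasInvariants Hs χ X p) (hΨ : IsBallChart χ X p Ψ w₀ t₀ r) :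
    IsGDMZ (Metric.ball w₀ r) (localRhs X p Ψ t₀) := by
  refine isGDMZ_of_isCompatibleAt Metric.isOpen_ball (fun i j _ => h.contDiffOn_localRhs hΨ i j)
    fun z hz i j k hij hik hjk => ?_
  refine apply_totalD_joinDiag_eq (w := z.toJ1) (t₀ := t₀) hjk hΨ.pos (fun t ht => ?_) z.2.2.2
  have hball := (mem_ball_joinDiag (z := joinDiag z.toJ1 t)).2 ⟨hz, ht⟩
  have hmem := hΨ.symm_mem hball
  have hderiv := fun i j (hij : i ≠ j) k => h.fderiv_localRhs_totalD hΨ hmem (i := i) (j := j) hij k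
  simp only [hΨ.phi_symm hball] at hderiv
  exact (hderiv i j hij k).trans (((h.isJetFrameAt (hΨ.source_subset hmem)).du₂_T i j k).trans
    (hderiv i k hik j).symm)

theorem Phi_mem_equationManifold (h : HasInvariants Hs χ X p)
    (hΨ : IsBallChart χ X p Ψ w₀ t₀ r) (hq : q ∈ Ψ.source) :
    Phi χ X p q ∈ equationManifold (Metric.ball w₀ r) (localRhs X p Ψ t₀) :=
  ⟨hΨ.toJ1_phi_mem_ball hq, fun i j hij =>
    (h.pSym_eq (hΨ.source_subset hq) i j).trans (h.p2_eq_localRhs hΨ hq hij.ne)⟩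

theorem image_Phi (h : HasInvariants Hs χ X p) (hΨ : IsBallChart χ X p Ψ w₀ t₀ r) :
    Phi χ X p '' Ψ.source = diagPart ⁻¹' Metric.ball (joinDiag w₀ t₀) r ∩
      equationManifold (Metric.ball w₀ r) (localRhs X p Ψ t₀) := by
  ext z
  constructor
  · rintro ⟨q, hq, rfl⟩
    refine ⟨?_, h.Phi_mem_equationManifold hΨ hq⟩
    rw [mem_preimage, diagPart_Phi]
    exact hΨ.phi_mem_ball hq
  · rintro ⟨hball, hz⟩
    have hmem := hΨ.symm_mem hball
    refine ⟨_, hmem, ?_⟩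
    rw [eq_equationParam_diagPart (h.Phi_mem_equationManifold hΨ hmem), diagPart_Phi,
      hΨ.phi_symm hball, ← eq_equationParam_diagPart hz]

end HasInvariants

theorem HasInvariants.exists_isGDMZ [CompleteSpace E] (h : HasInvariants Hs χ X p)
    (hq : q ∈ χ.source) :
    ∃ N : Set M, IsOpen N ∧ q ∈ N ∧ N ⊆ χ.source ∧
      ∃ (W : Set (J1 n)) (F : Fin n → Fin n → J1 n → ℝ), IsGDMZ W F ∧
        (∀ q' ∈ N, (phi χ X p q').toJ1 ∈ W ∧
          ∀ i j, i < j → p2 X p i j q' = F i j (phi χ X p q').toJ1) ∧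
        InjOn (Phi χ X p) N ∧
        ∃ O : Set (J2 n), IsOpen O ∧ Phi χ X p '' N = O ∩ equationManifold W F := by
  obtain ⟨Ψ, w₀, t₀, r, hΨ, hqΨ⟩ := h.exists_isBallChart hq
  exact ⟨Ψ.source, Ψ.open_source, hqΨ, hΨ.source_subset, Metric.ball w₀ r, localRhs X p Ψ t₀,
    h.isGDMZ_localRhs hΨ, fun q' hq' => ⟨hΨ.toJ1_phi_mem_ball hq', fun i j hij =>
      h.p2_eq_localRhs hΨ hq' hij.ne⟩, hΨ.injOn_Phi, _,
    Metric.isOpen_ball.preimage continuous_diagPart, h.image_Phi hΨ⟩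

end LocalEquation

end NHyp

theorem mainTheorem1_general {n : ℕ}
    {E : Type*} [NormedAddCommGroup E] [NormedSpace ℝ E]
    {M : Type*} [TopologicalSpace M] [ChartedSpace E M] [IsManifold 𝓘(ℝ, E) ∞ M]
    {Hs : Fin n → Distribution E M} {χ : CoordSystem n E M} {X : Fin n → VField E M} {p : M → ℝ}
    (h : HasInvariants Hs χ X p) :
    ((∀ q ∈ χ.source, Module.finrank ℝ (calA χ X q) = 2 * n) ∧
      IsIntegrableOn (calA χ X) χ.source) ∧
    IsLocalDiffeomorphOn 𝓘(ℝ, E) 𝓘(ℝ, JDiag n) ∞ (phi χ X p) χ.source ∧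
    (ContMDiffOn 𝓘(ℝ, E) 𝓘(ℝ, J2 n) ∞ (Phi χ X p) χ.source ∧
      ∀ q ∈ χ.source, Function.Injective (dPhi χ X p q)) ∧
    (∀ q ∈ χ.source, total Hs q = (contact n (Phi χ X p q)).comap (dPhi χ X p q)) ∧
    (∀ q ∈ χ.source, ∃ N : Set M, IsOpen N ∧ q ∈ N ∧ N ⊆ χ.source ∧
      ∃ (W : Set (J1 n)) (F : Fin n → Fin n → J1 n → ℝ), IsGDMZ W F ∧
        (∀ q' ∈ N, (phi χ X p q').toJ1 ∈ W ∧
          ∀ i j, i < j → p2 X p i j q' = F i j (phi χ X p q').toJ1) ∧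
        InjOn (Phi χ X p) N ∧
        ∃ O : Set (J2 n), IsOpen O ∧ Phi χ X p '' N = O ∩ equationManifold W F) ∧
    (∃ (π : Fin n → OneForm E M) (θ₀ : OneForm E M) (θ : Fin n → OneForm E M),
      (∀ i, SmoothFormOn (π i) χ.source) ∧ SmoothFormOn θ₀ χ.source ∧
      (∀ i, SmoothFormOn (θ i) χ.source) ∧
      (∀ q ∈ χ.source,
        LinearIndependent ℝ (Sum.elim (fun i : Fin n => dform (xfun χ i) q)
          (Sum.elim (fun i : Fin n => π i q)
            (Sum.elim (fun _ : Unit => θ₀ q) (fun i : Fin n => θ i q)))) ∧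
        (∀ v, v ∈ total Hs q ↔ θ₀ q v = 0 ∧ ∀ i, θ i q v = 0) ∧
        (∀ i j, π i q (X j q) = 0 ∧ π i q (ddu χ j q) = if i = j then 1 else 0)) ∧
      ExtDCongr (total Hs) χ.source θ₀ (fun _ _ _ => 0) ∧
      ∀ i, ExtDCongr (total Hs) χ.source (θ i) (wedge (π i) (dform (xfun χ i)))) ∧
    (∀ q ∈ χ.source,
      IsInvolutiveAt (total Hs) (fun i => dform (xfun χ i)) q ∧
      character (tableau (total Hs) (fun i => dform (xfun χ i)) q) 1 = n ∧
      ∀ k, 2 ≤ k → character (tableau (total Hs) (fun i => dform (xfun χ i)) q) k = 0) := by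
  have := h.finiteDimensional
  have := FiniteDimensional.complete ℝ E
  exact ⟨⟨fun q hq => h.finrank_calA hq, h.isIntegrableOn_calA⟩,
    h.isLocalDiffeomorphOn_phi,
    ⟨h.contMDiffOn_Phi, fun q hq => h.dPhi_injective hq⟩,
    fun q hq => h.total_eq_comap hq,
    fun q hq => h.exists_isGDMZ hq,
    ⟨piForm χ X p, thetaZero χ X p, thetaForm χ X p, h.smoothFormOn_piForm,
      h.smoothFormOn_thetaZero, h.smoothFormOn_thetaForm,
      fun q hq => ⟨h.linearIndependent_coframe hq, h.mem_total_iff_theta hq,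
        fun i j => ⟨h.piForm_X hq i j, h.piForm_ddu hq i j⟩⟩,
      h.extDCongr_thetaZero, h.extDCongr_thetaForm⟩,
    fun q hq => ⟨(h.isJetFrameAt hq).isInvolutiveAt h.isJetSystem hq,
      (h.isJetFrameAt hq).character_one h.isJetSystem hq,
      fun k hk => (h.isJetFrameAt hq).character_of_two_le h.isJetSystem hq hk⟩⟩

theorem mainTheorem1 {n : ℕ} (hn : 2 ≤ n)
    {E : Type*} [NormedAddCommGroup E] [NormedSpace ℝ E] [FiniteDimensional ℝ E]
    {M : Type*} [TopologicalSpace M] [ChartedSpace E M] [IsManifold 𝓘(ℝ, E) ∞ M]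
    (Hs : Fin n → Distribution E M) (hH : IsNHyperbolic Hs)
    (χ : CoordSystem n E M) (X : Fin n → VField E M) (hX : IsAdapted Hs χ X)
    (p : M → ℝ) (hp : SpansInvariants χ X p) :
    -- `𝒜` is an integrable distribution of rank `2n`
    ((∀ q ∈ χ.source, Module.finrank ℝ (calA χ X q) = 2 * n) ∧
      IsIntegrableOn (calA χ X) χ.source) ∧
    -- `(x, p, p_i, p_{ii})` are local coordinates
    IsLocalDiffeomorphOn 𝓘(ℝ, E) 𝓘(ℝ, JDiag n) ∞ (phi χ X p) χ.source ∧
    -- `Φ` is an immersion into `J²`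
    (ContMDiffOn 𝓘(ℝ, E) 𝓘(ℝ, J2 n) ∞ (Phi χ X p) χ.source ∧
      ∀ q ∈ χ.source, Function.Injective (dPhi χ X p q)) ∧
    -- `Φ` identifies `H` with the contact distribution
    (∀ q ∈ χ.source, total Hs q = (contact n (Phi χ X p q)).comap (dPhi χ X p q)) ∧
    -- locally, the image of `Φ` is an open part of the equation manifold of a GDMZ system whose
    -- right-hand sides are the `f_{ij}` as functions of `(x, p, p_k)` alone
    (∀ q ∈ χ.source, ∃ N : Set M, IsOpen N ∧ q ∈ N ∧ N ⊆ χ.source ∧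
      ∃ (W : Set (J1 n)) (F : Fin n → Fin n → J1 n → ℝ), IsGDMZ W F ∧
        (∀ q' ∈ N, (phi χ X p q').toJ1 ∈ W ∧
          ∀ i j, i < j → p2 X p i j q' = F i j (phi χ X p q').toJ1) ∧
        InjOn (Phi χ X p) N ∧
        ∃ O : Set (J2 n), IsOpen O ∧ Phi χ X p '' N = O ∩ equationManifold W F) ∧
    -- the structure equations, in a coframe `ω_i = dx_i, π_i, θ_0, …, θ_n`
    (∃ (π : Fin n → OneForm E M) (θ₀ : OneForm E M) (θ : Fin n → OneForm E M),
      (∀ i, SmoothFormOn (π i) χ.source) ∧ SmoothFormOn θ₀ χ.source ∧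
      (∀ i, SmoothFormOn (θ i) χ.source) ∧
      (∀ q ∈ χ.source,
        LinearIndependent ℝ (Sum.elim (fun i : Fin n => dform (xfun χ i) q)
          (Sum.elim (fun i : Fin n => π i q)
            (Sum.elim (fun _ : Unit => θ₀ q) (fun i : Fin n => θ i q)))) ∧
        (∀ v, v ∈ total Hs q ↔ θ₀ q v = 0 ∧ ∀ i, θ i q v = 0) ∧
        (∀ i j, π i q (X j q) = 0 ∧ π i q (ddu χ j q) = if i = j then 1 else 0)) ∧
      ExtDCongr (total Hs) χ.source θ₀ (fun _ _ _ => 0) ∧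
      ∀ i, ExtDCongr (total Hs) χ.source (θ i) (wedge (π i) (dform (xfun χ i)))) ∧
    -- `H` with independence forms `dx_i` is involutive: zero torsion, and the only nonzero Cartan
    -- character is `s₁ = n`
    (∀ q ∈ χ.source,
      IsInvolutiveAt (total Hs) (fun i => dform (xfun χ i)) q ∧
      character (tableau (total Hs) (fun i => dform (xfun χ i)) q) 1 = n ∧
      ∀ k, 2 ≤ k → character (tableau (total Hs) (fun i => dform (xfun χ i)) q) k = 0) :=
  mainTheorem1_general ⟨hH.dim_eq, fun i j hij q _ => hH.bracket_ne i j hij q, hX, hp⟩
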